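/- **Theorem 3.1.** Let $(M,g,J)$ be a (smooth) Kähler manifold of real dimension $2n\ge 6$, with Levi-Civita connection $\nabla$, curvature tensor $R(X,Y)Z=\nabla_X\nabla_YZ-\nabla_Y\nabla_XZ-\nabla_{[X,Y]}Z$, Ricci tensor $\rho(Y,Z)=\operatorname{tr}(X\mapsto R(X,Y)Z)$, scalar curvature $\tau$ and $\Delta=\operatorname{div}\operatorname{grad}$. *Notions.* For a smooth function $u:M\to\mathbb R$ put $\omega=du$, $P=\operatorname{grad}u$. Yano's complex conformal connection built from $u$ is $$\mathcal D_XY=\nabla_XY+\omega(X)Y+\omega(Y)X-g(X,Y)P-\omega(JX)JY-\omega(JY)JX-g(JX,Y)JP .$$ We say that $M$ *admits a flat complex conformal connection* if for some smooth $u$ that is not constant on any connected component of $M$ the connection $\mathcal D$ has zero curvature. Let $Q=\frac{1}{2(n+2)}\rho-\frac{\tau}{8(n+1)(n+2)}g$, and let $Q(X)$ also denote the corresponding $(1,1)$-tensor. $M$ is *Bochner-Kähler* if $$\begin{aligned}R(X,Y)Z={}&Q(Y,Z)X-Q(X,Z)Y+g(Y,Z)Q(X)-g(X,Z)Q(Y)\\&+Q(JY,Z)JX-Q(JX,Z)JY-2Q(JX,Y)JZ\\&+g(JY,Z)JQ(X)-g(JX,Z)JQ(Y)-2g(JX,Y)JQ(Z).\end{aligned}$$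 If $d\tau\neq0$ at every point, put $\xi=\operatorname{grad}\tau/\|d\tau\|$, $\eta=g(\xi,\cdot)$, and let the scalar distribution $D_\tau$ be the orthogonal complement of $\operatorname{span}\{\xi,J\xi\}$. $D_\tau$ is a *$B_0$-distribution* with functions $k,p^*:M\to\mathbb R$ if $d\tau\ne0$ and $k\neq0$ everywhere and $$\nabla_{x_0}\xi=\tfrac k2x_0\ (x_0\in D_\tau),\qquad \nabla_{J\xi}\xi=-p^*J\xi,\qquad \nabla_\xi\xi=0 .$$ Define tensors $\pi$ and $\Phi$ by $$4\pi(X,Y)Z=g(Y,Z)X-g(X,Z)Y-2g(JX,Y)JZ+g(JY,Z)JX-g(JX,Z)JY,$$ $$\begin{aligned}8\Phi(X,Y)Z={}&g(Y,Z)(\eta(X)\xi-\eta(JX)J\xi)-g(X,Z)(\eta(Y)\xi-\eta(JY)J\xi)\\ &+g(JY,Z)(\eta(X)J\xi+\eta(JX)\xi)-g(JX,Z)(\eta(Y)J\xi+\eta(JY)\xi)\\ &-2g(JX,Y)(\eta(Z)J\xi+\eta(JZ)\xi)\\ &+(\eta(Y)\eta(Z)+\eta(JY)\eta(JZ))X-(\eta(X)\eta(Z)+\eta(JX)\eta(JZ))Y\\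 &-(\eta(Y)\eta(JZ)-\eta(JY)\eta(Z))JX+(\eta(X)\eta(JZ)-\eta(JX)\eta(Z))JY\\ &+2(\eta(X)\eta(JY)-\eta(JX)\eta(Y))JZ .\end{aligned}$$ *Claims.* 1. If $M$ is Bochner-Kähler and $D_\tau$ is a $B_0$-distribution, then there are unique functions $a,b$ on $M$ with $R=a\pi+b\Phi$. Hence $a$ and $\mathfrak b_0=\frac{2a-b}{2}$ are well defined. 2. $M$ admits a flat complex conformal connection if and only if $M$ is Bochner-Kähler, $D_\tau$ is a $B_0$-distribution with $a+k^2=0$ on $M$, and $$\mathfrak B:=\|\rho\|^2-\frac{\tau^2}{2(n+1)}+\frac{\Delta\tau}{n+1}=0,\qquad \mathfrak b_0=0\qquad\text{on }M.$$ 3. If the conditions on the right-hand side of 2 hold, then $\tau<0$ on $M$, the function $u$ with $2u=-\ln(-\tau)$ is smooth, and the complex conformal connection built from this $u$ is flat. -/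

import Mathlib

open Bundle VectorField FiberBundle
open scoped Manifold ContDiff

noncomputable section
namespace KahlerGeom

variable {E : Type*} [NormedAddCommGroup E] [NormedSpace ℝ E]
  {H : Type*} [TopologicalSpace H] {I : ModelWithCorners ℝ E H}
  {M : Type*} [TopologicalSpace M] [ChartedSpace H M] [IsManifold I ∞ M]

/-- A smooth Riemannian metric on `M`; `g.inner x v w` is `g(v, w)` at the point `x`. -/
abbrev Metric (I : ModelWithCorners ℝ E H) (M : Type*) [TopologicalSpace M] [ChartedSpace H M]
    [IsManifold I ∞ M] :=
  ContMDiffRiemannianMetric I ∞ E (fun x : M ↦ TangentSpace I x)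

instance [FiniteDimensional ℝ E] (x : M) : FiniteDimensional ℝ (TangentSpace I x) :=
  inferInstanceAs (FiniteDimensional ℝ E)

instance (x : M) : T2Space (TangentSpace I x) :=
  inferInstanceAs (T2Space E)

theorem mdiffAt_inner (g : Metric I M) {V W : Π x : M, TangentSpace I x} {x : M}
    (hV : MDiffAt (T% V) x) (hW : MDiffAt (T% W) x) :
    MDiffAt (fun y ↦ g.inner y (V y) (W y)) x := by
  have : MDifferentiableAt I (I.prod 𝓘(ℝ)) 
      (fun m ↦ TotalSpace.mk' ℝ (E := Bundle.Trivial M ℝ) m (g.inner m (V m) (W m))) x := by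
    apply MDifferentiableAt.clm_bundle_apply₂ (F₁ := E) (F₂ := E)
    · exact g.contMDiff.mdifferentiableAt (by simp)
    · exact hV
    · exact hW
  simp only [mdifferentiableAt_totalSpace] at this
  exact this.2

theorem exists_orthonormalFrame [FiniteDimensional ℝ E] (g : Metric I M) (x : M) :
    ∃ e : Module.Basis (Fin (Module.finrank ℝ E)) ℝ (TangentSpace I x),
      ∀ i j, g.inner x (e i) (e j) = if i = j then 1 else 0 := by
  let c := g.toRiemannianMetric.toCore x
  let _ : NormedAddCommGroup (TangentSpace I x) := c.toNormedAddCommGroup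
  let _ : InnerProductSpace ℝ (TangentSpace I x) := InnerProductSpace.ofCore c.toCore
  have h : Module.finrank ℝ (TangentSpace I x) = Module.finrank ℝ E := rfl
  refine ⟨((stdOrthonormalBasis ℝ (TangentSpace I x)).reindex (finCongr h)).toBasis, fun i j ↦ ?_⟩
  have := ((stdOrthonormalBasis ℝ (TangentSpace I x)).reindex (finCongr h)).inner_eq_ite i j
  rw [OrthonormalBasis.coe_toBasis]
  exact this

/-- A `g`-orthonormal basis of the tangent space at `x`. Every trace below is a sum over it and does
not depend on the choice. -/
def frame [FiniteDimensional ℝ E] (g : Metric I M) (x : M) :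
    Module.Basis (Fin (Module.finrank ℝ E)) ℝ (TangentSpace I x) :=
  (exists_orthonormalFrame g x).choose

theorem inner_frame [FiniteDimensional ℝ E] (g : Metric I M) (x : M)
    (i j : Fin (Module.finrank ℝ E)) :
    g.inner x (frame g x i) (frame g x j) = if i = j then 1 else 0 :=
  (exists_orthonormalFrame g x).choose_spec i j

theorem sum_inner_frame_left [FiniteDimensional ℝ E] (g : Metric I M) (x : M) (v : TangentSpace I x) :
    ∑ i, g.inner x v (frame g x i) • frame g x i = v := by
  conv_rhs => rw [← (frame g x).sum_repr v]
  refine Finset.sum_congr rfl fun i _ ↦ ?_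
  congr 1
  conv_lhs => rw [← (frame g x).sum_repr v]
  simp only [map_sum, map_smul, sum_apply, smul_apply,
    inner_frame, smul_eq_mul, mul_ite, mul_one, mul_zero, Finset.sum_ite_eq', Finset.mem_univ,
    if_true]

/-- The right-hand side of the Koszul formula for `2 g(∇_X Y, Z)`. -/
def koszul (g : Metric I M) (X Y Z : Π x : M, TangentSpace I x) (x : M) : ℝ :=
  mvfderiv I (fun y ↦ g.inner y (Y y) (Z y)) x (X x)
    + mvfderiv I (fun y ↦ g.inner y (X y) (Z y)) x (Y x)
    - mvfderiv I (fun y ↦ g.inner y (X y) (Y y)) x (Z x)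
    + g.inner x (mlieBracket I X Y x) (Z x)
    - g.inner x (mlieBracket I X Z x) (Y x)
    - g.inner x (mlieBracket I Y Z x) (X x)

variable [FiniteDimensional ℝ E]

theorem koszul_tensorial (g : Metric I M) (Y Z : Π x : M, TangentSpace I x) (x : M)
    (hY : MDiffAt (T% Y) x) (hZ : MDiffAt (T% Z) x) :
    TensorialAt I E (fun X ↦ koszul g X Y Z x) x where
  smul {f X} hf hX := by
    have : CompleteSpace E := FiniteDimensional.complete ℝ E
    simp [koszul, mvfderiv_fun_mul hf (mdiffAt_inner g hX hZ),
      mvfderiv_fun_mul hf (mdiffAt_inner g hX hY), mlieBracket_smul_left hf hX]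
    ring
  add {X X'} hX hX' := by
    have : CompleteSpace E := FiniteDimensional.complete ℝ E
    simp [koszul, mvfderiv_fun_add (mdiffAt_inner g hX hZ) (mdiffAt_inner g hX' hZ),
      mvfderiv_fun_add (mdiffAt_inner g hX hY) (mdiffAt_inner g hX' hY),
      mlieBracket_add_left hX hX']
    ring

theorem koszul_tensorial' (g : Metric I M) (X Y : Π x : M, TangentSpace I x) (x : M)
    (hX : MDiffAt (T% X) x) (hY : MDiffAt (T% Y) x) :
    TensorialAt I E (fun Z ↦ koszul g X Y Z x) x where
  smul {f Z} hf hZ := by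
    have : CompleteSpace E := FiniteDimensional.complete ℝ E
    simp [koszul, mvfderiv_fun_mul hf (mdiffAt_inner g hX hZ),
      mvfderiv_fun_mul hf (mdiffAt_inner g hY hZ), mlieBracket_smul_right hf hZ,
      g.symm x (Z x)]
    ring
  add {Z Z'} hZ hZ' := by
    have : CompleteSpace E := FiniteDimensional.complete ℝ E
    simp [koszul, mvfderiv_fun_add (mdiffAt_inner g hX hZ) (mdiffAt_inner g hX hZ'),
      mvfderiv_fun_add (mdiffAt_inner g hY hZ) (mdiffAt_inner g hY hZ'),
      mlieBracket_add_right hZ hZ']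
    ring

theorem koszul_add (g : Metric I M) {X Y Y' Z : Π x : M, TangentSpace I x} {x : M}
    (hX : MDiffAt (T% X) x) (hY : MDiffAt (T% Y) x) (hY' : MDiffAt (T% Y') x)
    (hZ : MDiffAt (T% Z) x) :
    koszul g X (Y + Y') Z x = koszul g X Y Z x + koszul g X Y' Z x := by
  have : CompleteSpace E := FiniteDimensional.complete ℝ E
  simp [koszul, mvfderiv_fun_add (mdiffAt_inner g hY hZ) (mdiffAt_inner g hY' hZ),
      mvfderiv_fun_add (mdiffAt_inner g hX hY) (mdiffAt_inner g hX hY'),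
      mlieBracket_add_right hY hY', mlieBracket_add_left hY hY']
  ring

theorem koszul_smul (g : Metric I M) {f : M → ℝ} {X Y Z : Π x : M, TangentSpace I x} {x : M}
    (hf : MDiffAt f x)
    (hX : MDiffAt (T% X) x) (hY : MDiffAt (T% Y) x) (hZ : MDiffAt (T% Z) x) :
    koszul g X (f • Y) Z x =
      f x * koszul g X Y Z x + 2 * mvfderiv I f x (X x) * g.inner x (Y x) (Z x) := by
  have : CompleteSpace E := FiniteDimensional.complete ℝ E
  simp [koszul, mvfderiv_fun_mul hf (mdiffAt_inner g hY hZ),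
      mvfderiv_fun_mul hf (mdiffAt_inner g hX hY),
      mlieBracket_smul_right hf hY, mlieBracket_smul_left hf hY, g.symm x (X x)]
  ring

open Classical in
/-- `v ↦ ∇_v Y` at `x`, solved from the Koszul formula (value `0` if `Y` is not differentiable at
`x`). -/
def lcAux (g : Metric I M) (Y : Π x : M, TangentSpace I x) (x : M) :
    TangentSpace I x →L[ℝ] TangentSpace I x :=
  if hY : MDiffAt (T% Y) x then
    ∑ i, ((1 / 2 : ℝ) • TensorialAt.mkHom (fun X ↦ koszul g X Y (extend E (frame g x i)) x) x
      (koszul_tensorial g Y _ x hY (mdifferentiableAt_extend ..))).smulRight (frame g x i)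
  else 0

theorem inner_lcAux (g : Metric I M) {X Y Z : Π x : M, TangentSpace I x} {x : M}
    (hX : MDiffAt (T% X) x) (hY : MDiffAt (T% Y) x) (hZ : MDiffAt (T% Z) x) :
    g.inner x (lcAux g Y x (X x)) (Z x) = koszul g X Y Z x / 2 := by
  have key : ∀ i, TensorialAt.mkHom (fun X ↦ koszul g X Y (extend E (frame g x i)) x) x
      (koszul_tensorial g Y _ x hY (mdifferentiableAt_extend ..)) (X x)
      = TensorialAt.mkHom (fun Z ↦ koszul g X Y Z x) x (koszul_tensorial' g X Y x hX hY)
        (frame g x i) := fun i ↦ by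
    rw [TensorialAt.mkHom_apply _ hX, TensorialAt.mkHom_apply_eq_extend]
  rw [lcAux, dif_pos hY, ← TensorialAt.mkHom_apply (koszul_tensorial' g X Y x hX hY) hZ]
  conv_rhs => rw [← sum_inner_frame_left g x (Z x)]
  simp only [sum_apply, map_sum, map_smul, ContinuousLinearMap.smulRight_apply,
    smul_apply, key, smul_eq_mul, g.symm x (Z x), Finset.sum_div]
  exact Finset.sum_congr rfl fun i _ ↦ by ring

theorem eq_of_inner (g : Metric I M) {x : M} {v w : TangentSpace I x}
    (h : ∀ z, g.inner x v z = g.inner x w z) : v = w := by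
  rw [← sum_inner_frame_left g x v, ← sum_inner_frame_left g x w]
  simp [h]

/-- The Levi-Civita connection of `g`; `leviCivita g Y x v` is `∇_v Y` at `x`. It is torsion free and
metric by the two theorems that follow. -/
def leviCivita (g : Metric I M) : CovariantDerivative I E (TangentSpace I : M → Type _) where
  toFun := lcAux g
  isCovariantDerivativeOnUniv :=
    { add := by
        intro Y Y' x hY hY' _
        ext v
        refine eq_of_inner g fun z ↦ ?_
        have hv := mdifferentiableAt_extend I E v
        have hz := mdifferentiableAt_extend I E z
        have h1 := inner_lcAux g hv hY hz
        have h2 := inner_lcAux g hv hY' hz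
        have h3 := inner_lcAux g hv (mdifferentiableAt_add_section hY hY') hz
        rw [koszul_add g hv hY hY' hz] at h3
        simp at h1 h2 h3 ⊢
        linarith
      leibniz := by
        intro Y f x hY hf _
        ext v
        refine eq_of_inner g fun z ↦ ?_
        have hv := mdifferentiableAt_extend I E v
        have hz := mdifferentiableAt_extend I E z
        have h1 := inner_lcAux g hv hY hz
        have h3 := inner_lcAux g hv (hf.smul_section hY) hz
        rw [koszul_smul g hf hv hY hz] at h3
        simp at h1 h3 ⊢
        linear_combination h3 - f x * h1 }

theorem leviCivita_torsion (g : Metric I M) {X Y : Π x : M, TangentSpace I x} {x : M}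
    (hX : MDiffAt (T% X) x) (hY : MDiffAt (T% Y) x) :
    leviCivita g Y x (X x) - leviCivita g X x (Y x) = mlieBracket I X Y x := by
  refine eq_of_inner g fun z ↦ ?_
  have hz := mdifferentiableAt_extend I E z
  have h1 := inner_lcAux g hX hY hz
  have h2 := inner_lcAux g hY hX hz
  simp [koszul, leviCivita, g.symm _ (Y _) (X _), mlieBracket_swap_apply (V := Y) (W := X)] at h1 h2 ⊢
  linarith

theorem leviCivita_metric (g : Metric I M) {Y Z : Π x : M, TangentSpace I x} {x : M}
    (v : TangentSpace I x) (hY : MDiffAt (T% Y) x) (hZ : MDiffAt (T% Z) x) :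
    mvfderiv I (fun y ↦ g.inner y (Y y) (Z y)) x v =
      g.inner x (leviCivita g Y x v) (Z x) + g.inner x (Y x) (leviCivita g Z x v) := by
  have hv := mdifferentiableAt_extend I E v
  have h1 := inner_lcAux g hv hY hZ
  have h2 := inner_lcAux g hv hZ hY
  simp [koszul, leviCivita, g.symm _ (Z _) (Y _), g.symm _ (Y x) (lcAux g Z x _), mlieBracket_swap_apply (V := Z) (W := Y)] at h1 h2 ⊢
  linarith

/-- Abbreviation for connections on the tangent bundle. -/
abbrev Connection (I : ModelWithCorners ℝ E H) (M : Type*) [TopologicalSpace M] [ChartedSpace H M]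
    [IsManifold I ∞ M] :=
  CovariantDerivative I E (TangentSpace I : M → Type _)

/-- The curvature operator `D_X D_Y Z - D_Y D_X Z - D_[X,Y] Z` of a connection `D` on vector
fields. -/
def curvatureField (D : Connection I M) (X Y Z : Π x : M, TangentSpace I x) (x : M) :
    TangentSpace I x :=
  D (fun y ↦ D Z y (Y y)) x (X x) - D (fun y ↦ D Z y (X y)) x (Y x) - D Z x (mlieBracket I X Y x)

/-- The curvature tensor `R(u, v) w` at `x`: the curvature operator on extensions of the three
vectors to vector fields that are smooth near `x`. -/
def curvature (D : Connection I M) (x : M) (u v w : TangentSpace I x) : TangentSpace I x :=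
  curvatureField D (extend E u) (extend E v) (extend E w) x

/-- The connection `D` has zero curvature. -/
def IsFlat (D : Connection I M) : Prop :=
  ∀ (x : M) (u v w : TangentSpace I x), curvature D x u v w = 0

/-- A field of endomorphisms of the tangent spaces. -/
abbrev EndField (I : ModelWithCorners ℝ E H) (M : Type*) [TopologicalSpace M] [ChartedSpace H M] :=
  Π x : M, TangentSpace I x →L[ℝ] TangentSpace I x

/-- `(M, g, J)` is a Kähler manifold: `J` is a smooth almost complex structure, `g` is Hermitian, and
`J` is parallel for the Levi-Civita connection. -/
structure IsKahler (g : Metric I M) (J : EndField I M) : Prop where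
  smooth : ContMDiff I (I.prod 𝓘(ℝ, E →L[ℝ] E)) ∞
    (fun x : M ↦ (⟨x, J x⟩ :
      TotalSpace (E →L[ℝ] E) fun x : M ↦ TangentSpace I x →L[ℝ] TangentSpace I x))
  sq : ∀ (x : M) (v : TangentSpace I x), J x (J x v) = -v
  hermitian : ∀ (x : M) (v w : TangentSpace I x), g.inner x (J x v) (J x w) = g.inner x v w
  parallel : ∀ (Y : Π x : M, TangentSpace I x) (x : M) (v : TangentSpace I x),
    MDiffAt (T% Y) x → leviCivita g (fun y ↦ J y (Y y)) x v = J x (leviCivita g Y x v)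

section Riemannian

variable (g : Metric I M)

/-- The Riemannian curvature `R(u, v) w` at `x`. -/
def riem (x : M) (u v w : TangentSpace I x) : TangentSpace I x :=
  curvature (leviCivita g) x u v w

/-- The Ricci tensor `ρ(v, w)`, the trace of `u ↦ R(u, v) w`. -/
def ricci (x : M) (v w : TangentSpace I x) : ℝ :=
  ∑ i, g.inner x (riem g x (frame g x i) v w) (frame g x i)

/-- The scalar curvature `τ`. -/
def scal (x : M) : ℝ :=
  ∑ i, ricci g x (frame g x i) (frame g x i)

/-- The squared norm `‖ρ‖²` of the Ricci tensor. -/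
def ricciNormSq (x : M) : ℝ :=
  ∑ i, ∑ j, ricci g x (frame g x i) (frame g x j) ^ 2

/-- The gradient of `f`: the vector field with `g(grad f, v) = df(v)`. -/
def grad (f : M → ℝ) (x : M) : TangentSpace I x :=
  ∑ i, mvfderiv I f x (frame g x i) • frame g x i

/-- The Laplacian `div grad f`. -/
def laplacian (f : M → ℝ) (x : M) : ℝ :=
  ∑ i, g.inner x (leviCivita g (grad g f) x (frame g x i)) (frame g x i)

theorem inner_grad (f : M → ℝ) (x : M) (v : TangentSpace I x) :
    g.inner x (grad g f x) v = mvfderiv I f x v := by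
  conv_rhs => rw [← sum_inner_frame_left g x v]
  simp only [grad, map_sum, map_smul, sum_apply, smul_apply, smul_eq_mul, g.symm x v]
  exact Finset.sum_congr rfl fun i _ ↦ mul_comm _ _

end Riemannian

section Kahler

variable (n : ℕ) (g : Metric I M) (J : EndField I M)

/-- The tensor `Q(v, w) = ρ(v, w) / (2(n+2)) - τ g(v, w) / (8(n+1)(n+2))`, where `dim M = 2n`. -/
def bochnerQ (x : M) (v w : TangentSpace I x) : ℝ :=
  ricci g x v w / (2 * (n + 2)) - scal g x / (8 * (n + 1) * (n + 2)) * g.inner x v w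

/-- The tensor `Q` of type (1,1): `g(Q(v), w) = Q(v, w)`. -/
def bochnerQOp (x : M) (v : TangentSpace I x) : TangentSpace I x :=
  ∑ i, bochnerQ n g x v (frame g x i) • frame g x i

/-- The Bochner curvature tensor `B(R)(u, v) w` of a Kähler manifold of real dimension `2n`. -/
def bochnerTensor (x : M) (u v w : TangentSpace I x) : TangentSpace I x :=
  riem g x u v w
    - bochnerQ n g x v w • u + bochnerQ n g x u w • v
    - g.inner x v w • bochnerQOp n g x u + g.inner x u w • bochnerQOp n g x v
    - bochnerQ n g x (J x v) w • J x u + bochnerQ n g x (J x u) w • J x v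
    + (2 * bochnerQ n g x (J x u) v) • J x w
    - g.inner x (J x v) w • J x (bochnerQOp n g x u)
    + g.inner x (J x u) w • J x (bochnerQOp n g x v)
    + (2 * g.inner x (J x u) v) • J x (bochnerQOp n g x w)

/-- The Bochner curvature tensor vanishes identically. -/
def IsBochnerKahler : Prop :=
  ∀ (x : M) (u v w : TangentSpace I x), bochnerTensor n g J x u v w = 0

/-- The function `𝔅 = ‖ρ‖² - τ² / (2(n+1)) + Δτ / (n+1)` (a constant on a connected
Bochner-Kähler manifold). -/
def bochnerConst (x : M) : ℝ :=
  ricciNormSq g x - scal g x ^ 2 / (2 * (n + 1)) + laplacian g (scal g) x / (n + 1)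

/-- The unit vector field `ξ = grad τ / ‖dτ‖` (meaningful where `dτ ≠ 0`). -/
def xi (x : M) : TangentSpace I x :=
  (Real.sqrt (g.inner x (grad g (scal g) x) (grad g (scal g) x)))⁻¹ • grad g (scal g) x

/-- The 1-form `η = g(ξ, ·)`. -/
def eta (x : M) (v : TangentSpace I x) : ℝ :=
  g.inner x (xi g x) v

/-- The scalar distribution `D_τ`, the orthogonal complement of `span {ξ, Jξ}`. -/
def scalarDist (x : M) : Submodule ℝ (TangentSpace I x) :=
  LinearMap.ker (g.inner x (xi g x)).toLinearMap ⊓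
    LinearMap.ker (g.inner x (J x (xi g x))).toLinearMap

/-- `dτ` vanishes nowhere and the scalar distribution is a `B_0`-distribution with the functions
`k` and `p⋆`. -/
structure IsB0 (k p : M → ℝ) : Prop where
  dscal_ne : ∀ x : M, mvfderiv I (scal g) x ≠ 0
  k_ne : ∀ x, k x ≠ 0
  nabla_dist : ∀ (x : M), ∀ v ∈ scalarDist g J x, leviCivita g (xi g) x v = (k x / 2) • v
  nabla_Jxi : ∀ x : M, leviCivita g (xi g) x (J x (xi g x)) = -(p x • J x (xi g x))
  nabla_xi : ∀ x : M, leviCivita g (xi g) x (xi g x) = 0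

/-- The tensor `π`. -/
def piTensor (x : M) (u v w : TangentSpace I x) : TangentSpace I x :=
  (1 / 4 : ℝ) • (g.inner x v w • u - g.inner x u w • v - (2 * g.inner x (J x u) v) • J x w
    + g.inner x (J x v) w • J x u - g.inner x (J x u) w • J x v)

/-- The tensor `Φ`. -/
def phiTensor (x : M) (u v w : TangentSpace I x) : TangentSpace I x :=
  (1 / 8 : ℝ) •
    (g.inner x v w • (eta g x u • xi g x - eta g x (J x u) • J x (xi g x))
      - g.inner x u w • (eta g x v • xi g x - eta g x (J x v) • J x (xi g x))
      + g.inner x (J x v) w • (eta g x u • J x (xi g x) + eta g x (J x u) • xi g x)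
      - g.inner x (J x u) w • (eta g x v • J x (xi g x) + eta g x (J x v) • xi g x)
      - (2 * g.inner x (J x u) v) • (eta g x w • J x (xi g x) + eta g x (J x w) • xi g x)
      + (eta g x v * eta g x w + eta g x (J x v) * eta g x (J x w)) • u
      - (eta g x u * eta g x w + eta g x (J x u) * eta g x (J x w)) • v
      - (eta g x v * eta g x (J x w) - eta g x (J x v) * eta g x w) • J x u
      + (eta g x u * eta g x (J x w) - eta g x (J x u) * eta g x w) • J x v
      + (2 * (eta g x u * eta g x (J x v) - eta g x (J x u) * eta g x v)) • J x w)

/-- `a` and `b` are the curvature functions of the manifold: `R = a π + b Φ`. -/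
def IsCurvatureFunctions (a b : M → ℝ) : Prop :=
  ∀ (x : M) (u v w : TangentSpace I x),
    riem g x u v w = a x • piTensor g J x u v w + b x • phiTensor g J x u v w

/-- Bochner-Kähler, the scalar distribution is a `B_0`-distribution with `a + k² = 0`, and the
geometric constants `𝔅` and `𝔟_0 = (2a - b) / 2` vanish. -/
def IsSpecialBochnerKahler : Prop :=
  IsBochnerKahler n g J ∧
  ∃ k p a b : M → ℝ, IsB0 g J k p ∧ IsCurvatureFunctions g J a b ∧
    (∀ x, a x + k x ^ 2 = 0) ∧ (∀ x, bochnerConst n g x = 0) ∧ (∀ x, (2 * a x - b x) / 2 = 0)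

/-- The tensor `D_X Y - ∇_X Y` at `x`, as a bilinear map of `(Y, X)`, where `D` is the complex
conformal connection, `ω = du` and `P = grad u`. -/
def yanoTensor (u : M → ℝ) (x : M) :
    TangentSpace I x →L[ℝ] TangentSpace I x →L[ℝ] TangentSpace I x :=
  (LinearMap.mk₂ ℝ
    (fun Y X : TangentSpace I x ↦
      mvfderiv I u x X • Y + mvfderiv I u x Y • X - g.inner x X Y • grad g u x
        - mvfderiv I u x (J x X) • J x Y - mvfderiv I u x (J x Y) • J x X
        - g.inner x (J x X) Y • J x (grad g u x))
    (fun Y Y' X ↦ by simp only [map_add, add_smul, smul_add]; abel)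
    (fun c Y X ↦ by simp only [map_smul, smul_eq_mul]; module)
    (fun Y X X' ↦ by simp only [map_add, add_apply, add_smul, smul_add]; abel)
    (fun c Y X ↦ by simp only [map_smul, smul_apply, smul_eq_mul]; module)).toContinuousBilinearMap

/-- Yano's complex conformal connection built from the function `u`:
`D_X Y = ∇_X Y + ω(X) Y + ω(Y) X - g(X, Y) P - ω(JX) JY - ω(JY) JX - g(JX, Y) JP`. -/
def complexConformalConnection (u : M → ℝ) : Connection I M :=
  (leviCivita g).addOneForm (yanoTensor g J u)

theorem complexConformalConnection_apply (u : M → ℝ) (Y : Π x : M, TangentSpace I x) (x : M)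
    (X : TangentSpace I x) :
    complexConformalConnection g J u Y x X = leviCivita g Y x X
      + (mvfderiv I u x X • Y x + mvfderiv I u x (Y x) • X - g.inner x X (Y x) • grad g u x
        - mvfderiv I u x (J x X) • J x (Y x) - mvfderiv I u x (J x (Y x)) • J x X
        - g.inner x (J x X) (Y x) • J x (grad g u x)) :=
  rfl

end Kahler

end KahlerGeom
end

/-! Write `P = grad u` and `h = ∇P`. Since `g` and `J` are parallel, the curvature of Yano's
connection is `R` plus an algebraic expression in `h` and `P`
(`curvature_complexConformalConnection`). The torsion `-2 g(JX,Y) JP` is what makes flatness rigid: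
the Bianchi identity removes `R` from the cyclic sum, and the rest determines the Hessian, `h v =
-|P|² v + 2 g(P,Jv) JP` (`hess_of_flat`). For such a Hessian the curvature of Yano's connection is
`R + 4|P|² π + 8 Φ_P`, where `Φ_P` is `Φ` with `P` in place of `ξ` (`curvature_eq_of_hess`). This
lemma serves both directions.

Flat implies special. Contracting `R = -4|P|² π - 8 Φ_P` gives `τ = -4(n+1)(n+2)|P|²`, the Hessian
gives `grad τ = 8(n+1)(n+2)|P|² P`, and so `ξ = P/|P|`. Differentiating, `k = -2|P|`, `p* = 3|P|`,
`a = -4|P|²`, `b = 2a`. That `P` has no zeros follows from the first integral `|P|² e^{2u}`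
(`grad_ne_zero_of_flat`).

Existence of `a, b`. For `v` in `D_τ` the vector `R(v,Jv)ξ` is computed once from `Q` and once from
`∇ξ` (`riem_xi_of_isB0`). Comparison forces `Q` to be a combination of `g` and `η⊗η + ηJ⊗ηJ`
(`exists_bochnerQ_eq`), and for such `Q` the Bochner tensor is `R - (aπ + bΦ)`
(`bochnerTensor_of_bochnerQ`).

Special implies flat. With `a = -k²` and `b = 2a` one has `τ = -(n+1)(n+2)k²`. Components of
`R(·,·)ξ` give `p* = -3k/2` and `dk = (k²/2) η`. Hence `u = -½ ln(-τ)` has gradient `-(k/2) ξ`, its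
Hessian is the one above, and the three terms of the curvature cancel (`isFlat_log_scal`). -/

open scoped Topology

noncomputable section
namespace KahlerGeom
variable {E : Type*} [NormedAddCommGroup E] [NormedSpace ℝ E]
  {H : Type*} [TopologicalSpace H] {I : ModelWithCorners ℝ E H}
  {M : Type*} [TopologicalSpace M] [ChartedSpace H M] [IsManifold I ∞ M]

/-! ### Smooth vector fields, their brackets and covariant derivatives -/

section

/-- The vector field `V` is smooth at `x`. -/
abbrev SmoothAt (V : Π x : M, TangentSpace I x) (x : M) : Prop :=
  CMDiffAt ∞ (T% V) x

theorem SmoothAt.mdiffAt {V : Π x : M, TangentSpace I x} {x : M} (h : SmoothAt V x) :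
    MDiffAt (T% V) x :=
  h.mdifferentiableAt (by simp)

/-- `ContMDiffAt` of order `∞` at one point need not give order `∞` on a neighbourhood, but a finite
order does spread. Order one suffices for applying Leibniz rules near `x` before differentiating
once more. -/
theorem SmoothAt.eventually {V : Π x : M, TangentSpace I x} {x : M} (h : SmoothAt V x) :
    ∀ᶠ y in 𝓝 x, MDiffAt (T% V) y := by
  have h1 : CMDiffAt 1 (T% V) x := ContMDiffAt.of_le h (by simp)
  have := (contMDiffAt_iff_contMDiffAt_nhds (by simp)).1 h1
  exact this.mono fun y hy ↦ hy.mdifferentiableAt (by simp)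

theorem eventually_mdiffAt {f : M → ℝ} {x : M} (h : CMDiffAt ∞ f x) :
    ∀ᶠ y in 𝓝 x, MDiffAt f y := by
  have h1 : CMDiffAt 1 f x := ContMDiffAt.of_le h (by simp)
  have := (contMDiffAt_iff_contMDiffAt_nhds (by simp)).1 h1
  exact this.mono fun y hy ↦ hy.mdifferentiableAt (by simp)

theorem smoothAt_extend {x : M} (v : TangentSpace I x) : SmoothAt (extend E v) x :=
  contMDiffAt_extend I E v

theorem SmoothAt.add {V W : Π x : M, TangentSpace I x} {x : M} (hV : SmoothAt V x)
    (hW : SmoothAt W x) : SmoothAt (V + W) x :=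
  ContMDiffAt.add_section hV hW

theorem SmoothAt.sub {V W : Π x : M, TangentSpace I x} {x : M} (hV : SmoothAt V x)
    (hW : SmoothAt W x) : SmoothAt (V - W) x :=
  ContMDiffAt.sub_section hV hW

theorem SmoothAt.smul {f : M → ℝ} {V : Π x : M, TangentSpace I x} {x : M} (hf : CMDiffAt ∞ f x)
    (hV : SmoothAt V x) : SmoothAt (f • V) x :=
  ContMDiffAt.smul_section hf hV

theorem SmoothAt.congr {V W : Π x : M, TangentSpace I x} {x : M} (hV : SmoothAt V x)
    (h : ∀ᶠ y in 𝓝 x, W y = V y) : SmoothAt W x :=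
  ContMDiffAt.congr_of_eventuallyEq hV (h.mono fun y hy ↦ by simp [hy])

theorem SmoothAt.inner (g : Metric I M) {V W : Π x : M, TangentSpace I x} {x : M}
    (hV : SmoothAt V x) (hW : SmoothAt W x) : CMDiffAt ∞ (fun y ↦ g.inner y (V y) (W y)) x := by
  have : ContMDiffAt I (I.prod 𝓘(ℝ)) ∞
      (fun m ↦ TotalSpace.mk' ℝ (E := Bundle.Trivial M ℝ) m (g.inner m (V m) (W m))) x :=
    ContMDiffAt.clm_bundle_apply₂ (F₁ := E) (F₂ := E) g.contMDiff.contMDiffAt hV hW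
  simp only [contMDiffAt_totalSpace] at this
  exact this.2

theorem SmoothAt.mvfderiv {f : M → ℝ} {V : Π x : M, TangentSpace I x} {x : M}
    (hf : CMDiffAt ∞ f x) (hV : SmoothAt V x) : CMDiffAt ∞ (fun y ↦ mvfderiv I f y (V y)) x := by
  have h1 : CMDiffAt ∞ (fun y ↦ (tangentMap I 𝓘(ℝ) f ⟨y, V y⟩ : TangentBundle 𝓘(ℝ) ℝ)) x := by
    exact ContMDiffAt.clm_apply_of_inCoordinates (b₁ := id) (b₂ := f)
      (hf.mfderiv_const (m := ∞) (by simp)) hV hf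
  exact (contMDiff_snd_tangentBundle_modelSpace ℝ 𝓘(ℝ)).contMDiffAt.comp x h1

theorem SmoothAt.mlieBracket [FiniteDimensional ℝ E] {V W : Π x : M, TangentSpace I x} {x : M}
    (hV : SmoothAt V x) (hW : SmoothAt W x) : SmoothAt (mlieBracket I V W) x := by
  have : CompleteSpace E := FiniteDimensional.complete ℝ E
  have : IsManifold I (((⊤ : ℕ∞) : ℕ∞ω) + 1) M := by simpa using! ‹IsManifold I ∞ M›
  have : IsManifold I (minSmoothness ℝ 2) M := by
    rw [minSmoothness_of_isRCLikeNormedField]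
    exact IsManifold.of_le (n := ∞) (WithTop.coe_le_coe.2 (le_top (a := (2 : ℕ∞))))
  exact ContMDiffAt.mlieBracket_vectorField (n := ⊤) (m := ⊤) hV hW (by simp)

theorem contDiff_matrix_det {ι : Type*} [Fintype ι] [DecidableEq ι] :
    ContDiff ℝ ∞ (fun A : ι → ι → ℝ ↦ Matrix.det (Matrix.of A)) := by
  simp only [Matrix.det_apply, Matrix.of_apply]
  fun_prop

/-- A kernel vector of the Gram matrix would give a combination of the `s i` orthogonal to all of
them, hence to itself, contradicting positivity and independence. -/
theorem gram_det_ne_zero (g : Metric I M) {ι : Type*} [Fintype ι] [DecidableEq ι] {x : M}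
    {s : ι → TangentSpace I x} (hs : LinearIndependent ℝ s) :
    Matrix.det (Matrix.of fun i j ↦ g.inner x (s j) (s i)) ≠ 0 := by
  intro h0
  obtain ⟨v, hv, h⟩ := Matrix.exists_mulVec_eq_zero_iff.2 h0
  have hZ : ∀ i, g.inner x (∑ j, v j • s j) (s i) = 0 := fun i ↦ by
    have := congrFun h i
    simp only [Matrix.mulVec, dotProduct, Matrix.of_apply, Pi.zero_apply] at this
    simpa [mul_comm] using this
  have hZZ : g.inner x (∑ j, v j • s j) (∑ j, v j • s j) = 0 := by
    rw [map_sum (g.inner x (∑ j, v j • s j))]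
    exact Finset.sum_eq_zero fun i _ ↦ by rw [map_smul, hZ, smul_zero]
  have : ∑ j, v j • s j = 0 := by
    by_contra hne
    exact (g.pos x _ hne).ne' hZZ
  exact hv (funext fun i ↦ Fintype.linearIndependent_iff.1 hs v this i)

variable [FiniteDimensional ℝ E]

/-- A vector field is smooth if its inner products with smooth vector fields are. -/
theorem smoothAt_of_inner (g : Metric I M) {W : Π x : M, TangentSpace I x} {x : M}
    (h : ∀ V : Π x : M, TangentSpace I x, SmoothAt V x →
      CMDiffAt ∞ (fun y ↦ g.inner y (W y) (V y)) x) : SmoothAt W x := by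
  classical
  let e := trivializationAt E (TangentSpace I : M → Type _) x
  have hx : x ∈ e.baseSet := FiberBundle.mem_baseSet_trivializationAt' x
  let b := Module.finBasis ℝ E
  let s := e.localFrame b
  have hs : ∀ i, SmoothAt (s i) x := fun i ↦ contMDiffAt_localFrame_of_mem ∞ e b i hx
  refine (contMDiffAt_iff_localFrameCoeff b hx).2 fun i ↦ ?_
  -- The coefficients of `W` in the local frame solve a linear system with Gram matrix `G` and
  -- right-hand side `θ`, which are both smooth; Cramer's rule then makes the coefficients smooth.
  let G : M → Fin (Module.finrank ℝ E) → Fin (Module.finrank ℝ E) → ℝ :=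
    fun y i j ↦ g.inner y (s j y) (s i y)
  let θ : M → Fin (Module.finrank ℝ E) → ℝ := fun y i ↦ g.inner y (W y) (s i y)
  have hG : ContMDiffAt I 𝓘(ℝ, Fin (Module.finrank ℝ E) → Fin (Module.finrank ℝ E) → ℝ) ∞ G x := by
    refine contMDiffAt_pi_space.2 fun i ↦ contMDiffAt_pi_space.2 fun j ↦ ?_
    exact (hs j).inner g (hs i)
  have hdet : CMDiffAt ∞ (fun y ↦ Matrix.det (Matrix.of (G y))) x :=
    contDiff_matrix_det.contMDiff.contMDiffAt.comp x hG
  have hcr : CMDiffAt ∞ (fun y ↦ Matrix.cramer (Matrix.of (G y)) (θ y) i) x := by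
    simp only [Matrix.cramer_apply]
    refine ContMDiffAt.comp (g := fun A : Fin (Module.finrank ℝ E) → Fin (Module.finrank ℝ E) → ℝ ↦
      Matrix.det (Matrix.of A)) (I' := 𝓘(ℝ, Fin (Module.finrank ℝ E) →
        Fin (Module.finrank ℝ E) → ℝ)) (f := fun y k ↦ Function.update (G y k) i (θ y k))
      x contDiff_matrix_det.contMDiff.contMDiffAt ?_
    refine contMDiffAt_pi_space.2 fun k ↦ contMDiffAt_pi_space.2 fun j ↦ ?_
    by_cases hj : j = i
    · subst hj; simpa using h _ (hs k)
    · simpa [hj] using (hs j).inner g (hs k)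
  have hne : ∀ y ∈ e.baseSet, Matrix.det (Matrix.of (G y)) ≠ 0 := fun y hy ↦
    gram_det_ne_zero g ((e.isLocalFrameOn_localFrame_baseSet I ∞ b).linearIndependent hy)
  refine ContMDiffAt.congr_of_eventuallyEq
    (f := fun y ↦ (Matrix.det (Matrix.of (G y)))⁻¹ * Matrix.cramer (Matrix.of (G y)) (θ y) i) ?_ ?_
  · exact (hdet.inv₀ (hne x hx)).mul hcr
  · filter_upwards [e.open_baseSet.mem_nhds hx] with y hy
    have hθ : θ y = (Matrix.of (G y)).mulVec fun j ↦ e.localFrameCoeff I b j y (W y) := by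
      ext k
      simp only [θ, Matrix.mulVec, dotProduct, Matrix.of_apply, G]
      conv_lhs => rw [e.eq_sum_localFrameCoeff_smul (I := I) (b := b) (s := W) hy]
      simp only [map_sum, map_smul, sum_apply, smul_apply, smul_eq_mul]
      exact Finset.sum_congr rfl fun j _ ↦ mul_comm _ _
    rw [hθ, Matrix.cramer_eq_adjugate_mulVec, Matrix.mulVec_mulVec, Matrix.adjugate_mul,
      Matrix.smul_mulVec, Matrix.one_mulVec]
    rw [Pi.smul_apply, smul_eq_mul, inv_mul_cancel_left₀ (hne y hy)]
    rfl

theorem SmoothAt.koszul (g : Metric I M) {X Y Z : Π x : M, TangentSpace I x} {x : M}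
    (hX : SmoothAt X x) (hY : SmoothAt Y x) (hZ : SmoothAt Z x) :
    CMDiffAt ∞ (koszul g X Y Z) x := by
  unfold KahlerGeom.koszul
  exact (((((SmoothAt.mvfderiv (hY.inner g hZ) hX).add (SmoothAt.mvfderiv (hX.inner g hZ) hY)).sub
    (SmoothAt.mvfderiv (hX.inner g hY) hZ)).add ((hX.mlieBracket hY).inner g hZ)).sub
    ((hX.mlieBracket hZ).inner g hY)).sub ((hY.mlieBracket hZ).inner g hX)

theorem SmoothAt.leviCivita (g : Metric I M) {X Y : Π x : M, TangentSpace I x} {x : M}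
    (hX : SmoothAt X x) (hY : SmoothAt Y x) : SmoothAt (fun y ↦ leviCivita g Y y (X y)) x := by
  refine smoothAt_of_inner g fun Z hZ ↦ ?_
  refine ContMDiffAt.congr_of_eventuallyEq (f := fun y ↦ KahlerGeom.koszul g X Y Z y / 2) ?_ ?_
  · simp only [div_eq_mul_inv]
    exact (hX.koszul g hY hZ).mul contMDiffAt_const
  · filter_upwards [hX.eventually, hY.eventually, hZ.eventually] with y h1 h2 h3
    exact inner_lcAux g h1 h2 h3

theorem smoothAt_grad (g : Metric I M) {f : M → ℝ} {x : M} (hf : CMDiffAt ∞ f x) :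
    SmoothAt (grad g f) x := by
  refine smoothAt_of_inner g fun Z hZ ↦ ?_
  simp only [inner_grad]
  exact SmoothAt.mvfderiv hf hZ

theorem jacobi {U V W : Π x : M, TangentSpace I x} {x : M} (hU : SmoothAt U x) (hV : SmoothAt V x)
    (hW : SmoothAt W x) :
    mlieBracket I U (mlieBracket I V W) x =
      mlieBracket I (mlieBracket I U V) W x + mlieBracket I V (mlieBracket I U W) x := by
  have : CompleteSpace E := FiniteDimensional.complete ℝ E
  have : IsManifold I (minSmoothness ℝ 3) M := by
    rw [minSmoothness_of_isRCLikeNormedField]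
    exact IsManifold.of_le (n := ∞) (WithTop.coe_le_coe.2 (le_top (a := (3 : ℕ∞))))
  have h2 : minSmoothness ℝ 2 ≤ ∞ := by
    rw [minSmoothness_of_isRCLikeNormedField]; exact WithTop.coe_le_coe.2 (le_top (a := (2 : ℕ∞)))
  exact leibniz_identity_mlieBracket_apply (ContMDiffAt.of_le hU h2) (ContMDiffAt.of_le hV h2)
    (ContMDiffAt.of_le hW h2)

theorem mlieBracket_smul_eventually {f : M → ℝ} {V W : Π x : M, TangentSpace I x} {x : M}
    (hf : CMDiffAt ∞ f x) (hW : SmoothAt W x) :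
    mlieBracket I V (f • W) =ᶠ[𝓝 x]
      (fun y ↦ mvfderiv I f y (V y)) • W + f • mlieBracket I V W := by
  have : CompleteSpace E := FiniteDimensional.complete ℝ E
  filter_upwards [eventually_mdiffAt hf, hW.eventually] with y h1 h2
  rw [mlieBracket_smul_right h1 h2]
  rfl

/-- The Lie bracket is the commutator of derivations. -/
theorem mvfderiv_mlieBracket {f : M → ℝ} {V W : Π x : M, TangentSpace I x} {x : M}
    (hf : CMDiffAt ∞ f x) (hV : SmoothAt V x) (hW : SmoothAt W x) :
    mvfderiv I f x (mlieBracket I V W x) =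
      mvfderiv I (fun y ↦ mvfderiv I f y (W y)) x (V x)
        - mvfderiv I (fun y ↦ mvfderiv I f y (V y)) x (W x) := by
  have : CompleteSpace E := FiniteDimensional.complete ℝ E
  -- The identity is read off as the coefficient of a field `U` with `U x = u ≠ 0` in the Jacobi
  -- identity for `V`, `W`, `f • U`. This needs a nonzero tangent vector, so dimension zero is
  -- treated apart.
  rcases subsingleton_or_nontrivial (TangentSpace I x) with hE | hE
  · have h0 : ∀ v : TangentSpace I x, v = 0 := fun v ↦ Subsingleton.elim _ _
    rw [h0 (mlieBracket I V W x), h0 (V x), h0 (W x)]; simp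
  obtain ⟨u, hu⟩ := exists_ne (0 : TangentSpace I x)
  have hU := smoothAt_extend u
  have key := jacobi hV hW (SmoothAt.smul hf hU)
  have hVf := SmoothAt.mvfderiv hf hV
  have hWf := SmoothAt.mvfderiv hf hW
  have e1 := (mlieBracket_smul_eventually (V := W) hf hU)
  have e2 := (mlieBracket_smul_eventually (V := V) hf hU)
  rw [Filter.EventuallyEq.mlieBracket_vectorField_eq (V := V) .rfl e1,
    Filter.EventuallyEq.mlieBracket_vectorField_eq (V := W) .rfl e2,
    mlieBracket_add_right (hU.smul hWf).mdiffAt ((hW.mlieBracket hU).smul hf).mdiffAt,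
    mlieBracket_add_right (hU.smul hVf).mdiffAt ((hV.mlieBracket hU).smul hf).mdiffAt,
    mlieBracket_smul_right (hf.mdifferentiableAt (by simp)) hU.mdiffAt,
    mlieBracket_smul_right (hf.mdifferentiableAt (by simp)) (hW.mlieBracket hU).mdiffAt,
    mlieBracket_smul_right (hf.mdifferentiableAt (by simp)) (hV.mlieBracket hU).mdiffAt,
    mlieBracket_smul_right (hVf.mdifferentiableAt (by simp)) hU.mdiffAt,
    mlieBracket_smul_right (hWf.mdifferentiableAt (by simp)) hU.mdiffAt,
    jacobi hV hW hU] at key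
  simp only [extend_apply_self] at key
  have : (mvfderiv I f x (mlieBracket I V W x) -
      (mvfderiv I (fun y ↦ mvfderiv I f y (W y)) x (V x)
        - mvfderiv I (fun y ↦ mvfderiv I f y (V y)) x (W x))) • u = 0 := by
    rw [← sub_eq_zero] at key
    rw [← neg_eq_zero]
    refine Eq.trans ?_ key
    module
  linarith [(smul_eq_zero.1 this).resolve_right hu]

end

/-! ### Tensoriality and symmetries of the Riemannian curvature -/

section

section Connection

variable (D : Connection I M)

theorem cov_add {V W : Π x : M, TangentSpace I x} {x : M} (hV : SmoothAt V x) (hW : SmoothAt W x)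
    (v : TangentSpace I x) : D (V + W) x v = D V x v + D W x v := by
  rw [D.isCovariantDerivativeOnUniv.add hV.mdiffAt hW.mdiffAt]; rfl

theorem cov_smul {f : M → ℝ} {V : Π x : M, TangentSpace I x} {x : M} (hf : CMDiffAt ∞ f x)
    (hV : SmoothAt V x) (v : TangentSpace I x) :
    D (f • V) x v = f x • D V x v + mvfderiv I f x v • V x := by
  rw [D.isCovariantDerivativeOnUniv.leibniz hV.mdiffAt (hf.mdifferentiableAt (by simp))]; rfl

theorem cov_neg {V : Π x : M, TangentSpace I x} {x : M} (hV : SmoothAt V x)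
    (v : TangentSpace I x) : D (-V) x v = -D V x v := by
  have := cov_smul D (f := fun _ ↦ (-1 : ℝ)) contMDiffAt_const hV v
  have h : (fun _ ↦ (-1 : ℝ) : M → ℝ) • V = -V := funext fun y ↦ by simp
  rw [h, mvfderiv_const] at this
  simpa using this

theorem cov_sub {V W : Π x : M, TangentSpace I x} {x : M} (hV : SmoothAt V x) (hW : SmoothAt W x)
    (v : TangentSpace I x) : D (V - W) x v = D V x v - D W x v := by
  rw [sub_eq_add_neg, cov_add D hV (ContMDiffAt.neg_section hW), cov_neg D hW, sub_eq_add_neg]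

theorem cov_congr {V W : Π x : M, TangentSpace I x} {x : M} (hV : SmoothAt V x)
    (h : ∀ᶠ y in 𝓝 x, W y = V y) (v : TangentSpace I x) : D W x v = D V x v := by
  rw [D.isCovariantDerivativeOnUniv.congr_of_eventuallyEq (hV.congr h).mdiffAt hV.mdiffAt
    Filter.univ_mem h]

theorem curvatureField_swap (X Y Z : Π x : M, TangentSpace I x) (x : M) :
    curvatureField D X Y Z x = -curvatureField D Y X Z x := by
  simp only [curvatureField, mlieBracket_swap_apply (V := X) (W := Y), map_neg]
  abel

end Connection

omit [IsManifold I ∞ M] in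
theorem mvfderiv_congr {f₁ f₂ : M → ℝ} {x : M} (h : f₁ =ᶠ[𝓝 x] f₂) :
    mvfderiv I f₁ x = mvfderiv I f₂ x := by
  ext v
  exact congrArg (fun L : TangentSpace I x →L[ℝ] ℝ ↦ L v) h.mfderiv_eq

variable [FiniteDimensional ℝ E]

/-- An operation on smooth vector fields that is linear over smooth functions depends only on the
value at the point. -/
theorem eq_of_smooth_tensorial {A : Type*} [AddCommGroup A] [Module ℝ A]
    {Φ : (Π x : M, TangentSpace I x) → A} {x : M}
    (smul : ∀ {f : M → ℝ} {V : Π x : M, TangentSpace I x}, CMDiffAt ∞ f x → SmoothAt V x →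
      Φ (f • V) = f x • Φ V)
    (add : ∀ {V W : Π x : M, TangentSpace I x}, SmoothAt V x → SmoothAt W x →
      Φ (V + W) = Φ V + Φ W)
    {V W : Π x : M, TangentSpace I x} (hV : SmoothAt V x) (hW : SmoothAt W x) (h : V x = W x) :
    Φ V = Φ W := by
  classical
  -- Locality comes from linearity alone: `ψ` is the indicator of `{V = W}`, which is smooth at `x`
  -- because it is eventually `1` there, and `ψ • V = ψ • W` holds everywhere.
  have loc : ∀ {V W : Π x : M, TangentSpace I x}, SmoothAt V x → SmoothAt W x →
      (∀ᶠ y in 𝓝 x, V y = W y) → Φ V = Φ W := fun {V W} hV hW h ↦ by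
    let ψ (y : M) : ℝ := if V y = W y then 1 else 0
    have hψx : ψ x = 1 := by simp [ψ, h.self_of_nhds]
    have he : ψ • V = ψ • W := funext fun y ↦ by
      by_cases hy : V y = W y <;> simp [ψ, hy]
    have hψ : CMDiffAt ∞ ψ x := by
      have : CMDiffAt ∞ (fun _ : M ↦ (1 : ℝ)) x := contMDiffAt_const
      exact this.congr_of_eventuallyEq (h.mono fun y hy ↦ by simp [ψ, hy])
    have h1 := smul hψ hV
    have h2 := smul hψ hW
    rw [he, h2, hψx, one_smul, one_smul] at h1
    exact h1.symm
  let e := trivializationAt E (TangentSpace I : M → Type _) x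
  have hx : x ∈ e.baseSet := FiberBundle.mem_baseSet_trivializationAt' x
  let b := Module.finBasis ℝ E
  have hs : ∀ i, SmoothAt (e.localFrame b i) x :=
    fun i ↦ contMDiffAt_localFrame_of_mem ∞ e b i hx
  have hc : ∀ {V : Π x : M, TangentSpace I x}, SmoothAt V x → ∀ i,
      CMDiffAt ∞ (LinearMap.piApply (e.localFrameCoeff I b i) V) x :=
    fun hV i ↦ contMDiffAt_localFrameCoeff b hx hV i
  have zero : Φ 0 = 0 := by
    have h0 : SmoothAt (0 : Π x : M, TangentSpace I x) x := contMDiff_zeroSection ℝ _ |>.contMDiffAt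
    simpa using smul (f := fun _ ↦ (0 : ℝ)) contMDiffAt_const h0
  have h0 : SmoothAt (0 : Π x : M, TangentSpace I x) x := contMDiff_zeroSection ℝ _ |>.contMDiffAt
  have sum : ∀ (s : Finset (Fin (Module.finrank ℝ E)))
      (U : Fin (Module.finrank ℝ E) → Π x : M, TangentSpace I x),
      (∀ i, SmoothAt (U i) x) → SmoothAt (∑ i ∈ s, U i) x ∧ Φ (∑ i ∈ s, U i) = ∑ i ∈ s, Φ (U i) := by
    intro s U hU
    induction s using Finset.induction_on with
    | empty => exact ⟨by simpa using h0, by simpa using zero⟩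
    | insert a s ha ih =>
      rw [Finset.sum_insert ha, Finset.sum_insert ha]
      exact ⟨(hU a).add ih.1, by rw [add (hU a) ih.1, ih.2]⟩
  have expand : ∀ {V : Π x : M, TangentSpace I x}, SmoothAt V x →
      Φ V = ∑ i, e.localFrameCoeff I b i x (V x) • Φ (e.localFrame b i) := fun {V} hV ↦ by
    obtain ⟨h1, h2⟩ := sum Finset.univ
      (fun i ↦ LinearMap.piApply (e.localFrameCoeff I b i) V • e.localFrame b i)
      fun i ↦ (hs i).smul (hc hV i)
    rw [loc hV h1 ?_, h2]
    · exact Finset.sum_congr rfl fun i _ ↦ smul (hc hV i) (hs i)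
    · filter_upwards [e.eventually_eq_localFrame_sum_coeff_smul (I := I) b hx (s := V)] with y hy
      rw [Finset.sum_apply]
      exact hy
  rw [expand hV, expand hW, h]


variable (g : Metric I M)

theorem mlieBracket_eq {X Y : Π x : M, TangentSpace I x} {x : M} (hX : SmoothAt X x)
    (hY : SmoothAt Y x) :
    mlieBracket I X Y x = leviCivita g Y x (X x) - leviCivita g X x (Y x) :=
  (leviCivita_torsion g hX.mdiffAt hY.mdiffAt).symm


variable {X Y Z W : Π x : M, TangentSpace I x} {x : M}

theorem curvatureField_add_left {X' : Π x : M, TangentSpace I x}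
    (hX : SmoothAt X x) (hX' : SmoothAt X' x) (hZ : SmoothAt Z x) :
    curvatureField (leviCivita g) (X + X') Y Z x =
      curvatureField (leviCivita g) X Y Z x + curvatureField (leviCivita g) X' Y Z x := by
  have : CompleteSpace E := FiniteDimensional.complete ℝ E
  have h := cov_add (leviCivita g) (hX.leviCivita g hZ) (hX'.leviCivita g hZ) (Y x)
  have e : (fun y ↦ leviCivita g Z y ((X + X') y)) =
      (fun y ↦ leviCivita g Z y (X y)) + fun y ↦ leviCivita g Z y (X' y) :=
    funext fun y ↦ by simp
  rw [curvatureField, e, h]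
  simp only [curvatureField, mlieBracket_add_left hX.mdiffAt hX'.mdiffAt, Pi.add_apply,
    map_add]
  abel

theorem curvatureField_smul_left {f : M → ℝ} (hf : CMDiffAt ∞ f x)
    (hX : SmoothAt X x) (hZ : SmoothAt Z x) :
    curvatureField (leviCivita g) (f • X) Y Z x = f x • curvatureField (leviCivita g) X Y Z x := by
  have : CompleteSpace E := FiniteDimensional.complete ℝ E
  have h := cov_smul (leviCivita g) hf (hX.leviCivita g hZ) (Y x)
  have e : (fun y ↦ leviCivita g Z y ((f • X) y)) = f • (fun y ↦ leviCivita g Z y (X y)) :=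
    funext fun y ↦ by simp
  rw [curvatureField, e, h]
  simp only [curvatureField, mlieBracket_smul_left (hf.mdifferentiableAt (by simp))
    hX.mdiffAt, Pi.smul_apply', map_add, map_smul]
  module

theorem curvatureField_add_right {Z' : Π x : M, TangentSpace I x}
    (hX : SmoothAt X x) (hY : SmoothAt Y x) (hZ : SmoothAt Z x) (hZ' : SmoothAt Z' x) :
    curvatureField (leviCivita g) X Y (Z + Z') x =
      curvatureField (leviCivita g) X Y Z x + curvatureField (leviCivita g) X Y Z' x := by
  have key : ∀ {X Y : Π x : M, TangentSpace I x}, SmoothAt X x → SmoothAt Y x →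
      leviCivita g (fun y ↦ leviCivita g (Z + Z') y (Y y)) x (X x) =
      leviCivita g (fun y ↦ leviCivita g Z y (Y y)) x (X x) +
        leviCivita g (fun y ↦ leviCivita g Z' y (Y y)) x (X x) := fun {X Y} hX hY ↦ by
    rw [← cov_add _ (hY.leviCivita g hZ) (hY.leviCivita g hZ')]
    refine cov_congr _ ((hY.leviCivita g hZ).add (hY.leviCivita g hZ')) ?_ _
    filter_upwards [hZ.eventually, hZ'.eventually] with y h1 h2
    rw [(leviCivita g).isCovariantDerivativeOnUniv.add h1 h2]; rfl
  simp only [curvatureField, key hX hY, key hY hX, cov_add _ hZ hZ']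
  abel

/-- The mixed first-order terms are symmetric in `X, Y`, and the second derivatives of `f`
antisymmetrize to `df([X,Y])`, which the bracket term cancels. -/
theorem curvatureField_smul_right {f : M → ℝ} (hf : CMDiffAt ∞ f x)
    (hX : SmoothAt X x) (hY : SmoothAt Y x) (hZ : SmoothAt Z x) :
    curvatureField (leviCivita g) X Y (f • Z) x = f x • curvatureField (leviCivita g) X Y Z x := by
  have key : ∀ {X Y : Π x : M, TangentSpace I x}, SmoothAt X x → SmoothAt Y x →
      leviCivita g (fun y ↦ leviCivita g (f • Z) y (Y y)) x (X x) =
      f x • leviCivita g (fun y ↦ leviCivita g Z y (Y y)) x (X x) +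
        mvfderiv I f x (X x) • leviCivita g Z x (Y x)
        + mvfderiv I f x (Y x) • leviCivita g Z x (X x)
        + mvfderiv I (fun y ↦ mvfderiv I f y (Y y)) x (X x) • Z x := fun {X Y} hX hY ↦ by
    have hYf := SmoothAt.mvfderiv hf hY
    have h1 := cov_add (leviCivita g) ((hY.leviCivita g hZ).smul hf) (hZ.smul hYf) (X x)
    rw [cov_smul _ hf (hY.leviCivita g hZ), cov_smul _ hYf hZ] at h1
    rw [add_assoc, ← h1]
    refine cov_congr _ (((hY.leviCivita g hZ).smul hf).add (hZ.smul hYf)) ?_ _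
    filter_upwards [hZ.eventually, eventually_mdiffAt hf] with y h1 h2
    rw [(leviCivita g).isCovariantDerivativeOnUniv.leibniz h1 h2]; rfl
  simp only [curvatureField, key hX hY, key hY hX, cov_smul _ hf hZ, mvfderiv_mlieBracket hf hX hY]
  module

/-- Frees `riem` from the particular extensions in its definition, so that the curvature can be
computed with fields adapted to the geometry. -/
theorem riem_eq (hX : SmoothAt X x) (hY : SmoothAt Y x) (hZ : SmoothAt Z x) :
    riem g x (X x) (Y x) (Z x) = curvatureField (leviCivita g) X Y Z x := by
  have hX' := smoothAt_extend (X x)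
  have hY' := smoothAt_extend (Y x)
  have hZ' := smoothAt_extend (Z x)
  have h1 : ∀ {X X' Y Z : Π x : M, TangentSpace I x}, SmoothAt X x → SmoothAt X' x →
      SmoothAt Z x → X x = X' x →
      curvatureField (leviCivita g) X Y Z x = curvatureField (leviCivita g) X' Y Z x :=
    fun {X X' Y Z} hX hX' hZ h ↦ eq_of_smooth_tensorial
      (Φ := fun X ↦ curvatureField (leviCivita g) X Y Z x)
      (fun hf hV ↦ curvatureField_smul_left g hf hV hZ)
      (fun hV hW ↦ curvatureField_add_left g hV hW hZ) hX hX' h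
  have h2 : curvatureField (leviCivita g) X Y (extend E (Z x)) x =
      curvatureField (leviCivita g) X Y Z x := eq_of_smooth_tensorial
      (Φ := fun Z ↦ curvatureField (leviCivita g) X Y Z x)
      (fun hf hV ↦ curvatureField_smul_right g hf hX hY hV)
      (fun hV hW ↦ curvatureField_add_right g hX hY hV hW) hZ' hZ (by simp)
  rw [riem, curvature, h1 hX' hX hZ' (by simp), curvatureField_swap, h1 hY' hY hZ' (by simp),
    ← curvatureField_swap, h2]

theorem riem_smooth (hX : SmoothAt X x) (hY : SmoothAt Y x) (hZ : SmoothAt Z x) :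
    SmoothAt (fun y ↦ curvatureField (leviCivita g) X Y Z y) x :=
  ((hX.leviCivita g (hY.leviCivita g hZ)).sub (hY.leviCivita g (hX.leviCivita g hZ))).sub
    ((hX.mlieBracket hY).leviCivita g hZ)

theorem riem_swap (u v w : TangentSpace I x) : riem g x u v w = -riem g x v u w :=
  curvatureField_swap ..

theorem riem_add_left (u u' v w : TangentSpace I x) :
    riem g x (u + u') v w = riem g x u v w + riem g x u' v w := by
  have h := curvatureField_add_left g (Y := extend E v) (smoothAt_extend u) (smoothAt_extend u')
    (smoothAt_extend w)
  rw [← riem_eq g ((smoothAt_extend u).add (smoothAt_extend u')) (smoothAt_extend v)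
    (smoothAt_extend w)] at h
  simpa using! h

theorem riem_smul_left (c : ℝ) (u v w : TangentSpace I x) :
    riem g x (c • u) v w = c • riem g x u v w := by
  have h := curvatureField_smul_left g (f := fun _ ↦ c) (Y := extend E v) contMDiffAt_const
    (smoothAt_extend u) (smoothAt_extend w)
  rw [← riem_eq g ((smoothAt_extend u).smul contMDiffAt_const) (smoothAt_extend v)
    (smoothAt_extend w)] at h
  simpa using! h

theorem riem_add_mid (u v v' w : TangentSpace I x) :
    riem g x u (v + v') w = riem g x u v w + riem g x u v' w := by
  rw [riem_swap, riem_add_left, riem_swap g v, riem_swap g v']; abel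

theorem riem_smul_mid (c : ℝ) (u v w : TangentSpace I x) :
    riem g x u (c • v) w = c • riem g x u v w := by
  rw [riem_swap, riem_smul_left, riem_swap g v]; simp

theorem riem_add_right (u v w w' : TangentSpace I x) :
    riem g x u v (w + w') = riem g x u v w + riem g x u v w' := by
  have h := curvatureField_add_right g (smoothAt_extend u) (smoothAt_extend v)
    (smoothAt_extend w) (smoothAt_extend w')
  rw [← riem_eq g (smoothAt_extend u) (smoothAt_extend v)
    ((smoothAt_extend w).add (smoothAt_extend w'))] at h
  simpa using! h

theorem riem_smul_right (c : ℝ) (u v w : TangentSpace I x) :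
    riem g x u v (c • w) = c • riem g x u v w := by
  have h := curvatureField_smul_right g (f := fun _ ↦ c) contMDiffAt_const
    (smoothAt_extend u) (smoothAt_extend v) (smoothAt_extend w)
  rw [← riem_eq g (smoothAt_extend u) (smoothAt_extend v)
    ((smoothAt_extend w).smul contMDiffAt_const)] at h
  simpa using! h

/-- Torsion-freeness turns each pair of second derivatives, with its bracket term, into a double
bracket; the cyclic sum is then the Jacobi identity. -/
theorem riem_bianchi (u v w : TangentSpace I x) :
    riem g x u v w + riem g x v w u + riem g x w u v = 0 := by
  have hu := smoothAt_extend u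
  have hv := smoothAt_extend v
  have hw := smoothAt_extend w
  have key : ∀ {X Y Z : Π x : M, TangentSpace I x}, SmoothAt X x → SmoothAt Y x → SmoothAt Z x →
      leviCivita g (fun y ↦ leviCivita g Z y (Y y)) x (X x)
        - leviCivita g (fun y ↦ leviCivita g Y y (Z y)) x (X x)
        - leviCivita g X x (mlieBracket I Y Z x) = mlieBracket I X (mlieBracket I Y Z) x :=
    fun {X Y Z} hX hY hZ ↦ by
    rw [mlieBracket_eq g hX (hY.mlieBracket hZ),
      ← cov_sub _ (hY.leviCivita g hZ) (hZ.leviCivita g hY)]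
    congr 1
    refine (cov_congr _ ((hY.leviCivita g hZ).sub (hZ.leviCivita g hY)) ?_ _).symm
    filter_upwards [hY.eventually, hZ.eventually] with y h1 h2
    exact (leviCivita_torsion g h1 h2).symm
  have k1 := key hu hv hw
  have k2 := key hv hw hu
  have k3 := key hw hu hv
  have j := jacobi hu hv hw
  have s1 : mlieBracket I (extend E w) (mlieBracket I (extend E u) (extend E v)) x =
      -mlieBracket I (mlieBracket I (extend E u) (extend E v)) (extend E w) x :=
    mlieBracket_swap_apply
  have s2 : mlieBracket I (extend E v) (mlieBracket I (extend E w) (extend E u)) x =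
      -mlieBracket I (extend E v) (mlieBracket I (extend E u) (extend E w)) x := by
    rw [mlieBracket_eq g hv (hw.mlieBracket hu), mlieBracket_eq g hv (hu.mlieBracket hw),
      mlieBracket_swap (V := extend E w) (W := extend E u),
      cov_neg _ (hu.mlieBracket hw)]
    simp only [Pi.neg_apply, map_neg]
    abel
  simp only [riem, curvature, curvatureField]
  rw [s1] at k3
  rw [s2] at k2
  rw [j] at k1
  have := congr($k1 + $k2 + $k3)
  rw [← sub_eq_zero] at this
  refine Eq.trans ?_ this
  abel

/-- Apply `[u,v] = uv - vu` to the function `g(w,z)` and expand by metric compatibility; the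
products of first derivatives are symmetric in `u, v` and drop out. -/
theorem inner_riem_skew (u v w z : TangentSpace I x) :
    g.inner x (riem g x u v w) z = -g.inner x w (riem g x u v z) := by
  have hu := smoothAt_extend u
  have hv := smoothAt_extend v
  have hw := smoothAt_extend w
  have hz := smoothAt_extend z
  have key : ∀ {X Y Z W : Π x : M, TangentSpace I x}, SmoothAt X x → SmoothAt Y x →
      SmoothAt Z x → SmoothAt W x →
      mvfderiv I (fun y ↦ mvfderiv I (fun y ↦ g.inner y (Z y) (W y)) y (Y y)) x (X x) =
      g.inner x (leviCivita g (fun y ↦ leviCivita g Z y (Y y)) x (X x)) (W x)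
      + g.inner x (leviCivita g Z x (Y x)) (leviCivita g W x (X x))
      + g.inner x (leviCivita g Z x (X x)) (leviCivita g W x (Y x))
      + g.inner x (Z x) (leviCivita g (fun y ↦ leviCivita g W y (Y y)) x (X x)) :=
    fun {X Y Z W} hX hY hZ hW ↦ by
    have h1 := leviCivita_metric g (X x) (hY.leviCivita g hZ).mdiffAt hW.mdiffAt
    have h2 := leviCivita_metric g (X x) hZ.mdiffAt (hY.leviCivita g hW).mdiffAt
    have h3 := mvfderiv_fun_add (((hY.leviCivita g hZ).inner g hW).mdifferentiableAt (by simp))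
      ((hZ.inner g (hY.leviCivita g hW)).mdifferentiableAt (by simp))
    have h4 : (fun y ↦ mvfderiv I (fun y ↦ g.inner y (Z y) (W y)) y (Y y)) =ᶠ[𝓝 x]
        fun y ↦ g.inner y (leviCivita g Z y (Y y)) (W y)
          + g.inner y (Z y) (leviCivita g W y (Y y)) := by
      filter_upwards [hZ.eventually, hW.eventually] with y h5 h6
      exact leviCivita_metric g (Y y) h5 h6
    have h5 : mvfderiv I (fun y ↦ mvfderiv I (fun y ↦ g.inner y (Z y) (W y)) y (Y y)) x =
        mvfderiv I (fun y ↦ g.inner y (leviCivita g Z y (Y y)) (W y)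
          + g.inner y (Z y) (leviCivita g W y (Y y))) x := mvfderiv_congr h4
    rw [h5, h3, add_apply, h1, h2]
    ring
  have k1 := key hu hv hw hz
  have k2 := key hv hu hw hz
  have k3 := mvfderiv_mlieBracket (hw.inner g hz) hu hv
  rw [leviCivita_metric g _ hw.mdiffAt hz.mdiffAt] at k3
  simp only [riem, curvature, curvatureField, map_sub, sub_apply]
  simp only [extend_apply_self] at *
  linarith

/-- The classical octahedron argument: four instances of the Bianchi identity, reduced by the two
skew symmetries. -/
theorem riem_pair (u v w z : TangentSpace I x) :
    g.inner x (riem g x u v w) z = g.inner x (riem g x w z u) v := by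
  have S : ∀ u v w z : TangentSpace I x,
      g.inner x (riem g x u v w) z = -g.inner x (riem g x u v z) w := fun u v w z ↦ by
    rw [inner_riem_skew, g.symm]
  have A : ∀ u v w z : TangentSpace I x,
      g.inner x (riem g x u v w) z = -g.inner x (riem g x v u w) z := fun u v w z ↦ by
    rw [riem_swap]; simp
  have B : ∀ u v w z : TangentSpace I x, g.inner x (riem g x u v w) z
      + g.inner x (riem g x v w u) z + g.inner x (riem g x w u v) z = 0 := fun u v w z ↦ by
    have := congr(g.inner x $(riem_bianchi g u v w) z)
    simpa using this
  linarith [B u v w z, B v w z u, B w z u v, B z u v w, S u v w z, S v w u z, S w u v z,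
    S v w z u, S w z v u, S z v w u, S w z u v, S z u w v, S u w z v, S z u v w, S u v z w,
    S v z u w, A u v w z, A v w u z, A w u v z, A u v z w, A v w z u, A w u z v, A z v w u,
    A z v u w, A w z u v, A w z v u, A z u v w, A z u w v]

end

/-! ### Traces, the Ricci tensor and the Kähler symmetries -/

section

variable [FiniteDimensional ℝ E]

section Trace

variable (g : Metric I M) {x : M}

theorem frame_repr (v : TangentSpace I x) (i : Fin (Module.finrank ℝ E)) :
    (frame g x).repr v i = g.inner x v (frame g x i) := by
  conv_lhs => rw [← sum_inner_frame_left g x v]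
  simp [Finsupp.single_apply]

theorem sum_inner_frame_eq_trace (A : TangentSpace I x →ₗ[ℝ] TangentSpace I x) :
    ∑ i, g.inner x (A (frame g x i)) (frame g x i) = LinearMap.trace ℝ _ A := by
  rw [LinearMap.trace_eq_matrix_trace ℝ (frame g x), Matrix.trace]
  refine Finset.sum_congr rfl fun i _ ↦ ?_
  rw [Matrix.diag_apply, LinearMap.toMatrix_apply, frame_repr]

/-- `frame` is chosen at each point separately and carries no continuity. As the trace does not
depend on the basis, it may be computed in a smooth local frame. -/
theorem contMDiffAt_trace (A : Π y : M, TangentSpace I y →ₗ[ℝ] TangentSpace I y)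
    (h : ∀ i, SmoothAt (fun y ↦ A y ((trivializationAt E (TangentSpace I : M → Type _) x).localFrame
      (Module.finBasis ℝ E) i y)) x) :
    CMDiffAt ∞ (fun y ↦ ∑ i, g.inner y (A y (frame g y i)) (frame g y i)) x := by
  let e := trivializationAt E (TangentSpace I : M → Type _) x
  have hx : x ∈ e.baseSet := FiberBundle.mem_baseSet_trivializationAt' x
  let b := Module.finBasis ℝ E
  refine ContMDiffAt.congr_of_eventuallyEq
    (f := fun y ↦ ∑ i, e.localFrameCoeff I b i y (A y (e.localFrame b i y))) ?_ ?_
  · exact ContMDiffAt.sum fun i _ ↦ contMDiffAt_localFrameCoeff b hx (h i) i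
  · filter_upwards [e.open_baseSet.mem_nhds hx] with y hy
    rw [sum_inner_frame_eq_trace, LinearMap.trace_eq_matrix_trace ℝ (e.basisAt b hy), Matrix.trace]
    refine Finset.sum_congr rfl fun i _ ↦ ?_
    rw [Matrix.diag_apply, LinearMap.toMatrix_apply,
      e.localFrameCoeff_apply_of_mem_baseSet (I := I) b hy (fun z ↦ A z (e.localFrame b i z)),
      e.localFrame_apply_of_mem_baseSet b hy]

theorem ricci_add_left (v v' w : TangentSpace I x) :
    ricci g x (v + v') w = ricci g x v w + ricci g x v' w := by
  simp [ricci, riem_add_mid, Finset.sum_add_distrib]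

theorem ricci_smul_left (c : ℝ) (v w : TangentSpace I x) :
    ricci g x (c • v) w = c * ricci g x v w := by
  simp [ricci, riem_smul_mid, Finset.mul_sum]

theorem ricci_add_right (v w w' : TangentSpace I x) :
    ricci g x v (w + w') = ricci g x v w + ricci g x v w' := by
  simp [ricci, riem_add_right, Finset.sum_add_distrib]

theorem ricci_smul_right (c : ℝ) (v w : TangentSpace I x) :
    ricci g x v (c • w) = c * ricci g x v w := by
  simp [ricci, riem_smul_right, Finset.mul_sum]

theorem ricci_symm (v w : TangentSpace I x) : ricci g x v w = ricci g x w v := by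
  refine Finset.sum_congr rfl fun i _ ↦ ?_
  rw [riem_pair, riem_swap, map_neg, neg_apply, inner_riem_skew, neg_neg, g.symm]

/-- The Ricci tensor as a bilinear form. -/
def ricciForm (x : M) : TangentSpace I x →ₗ[ℝ] TangentSpace I x →ₗ[ℝ] ℝ :=
  LinearMap.mk₂ ℝ (ricci g x) (ricci_add_left g) (ricci_smul_left g) (ricci_add_right g)
    (ricci_smul_right g)

/-- The Ricci operator. -/
def ricciOp (x : M) : TangentSpace I x →ₗ[ℝ] TangentSpace I x :=
  ∑ i, ((ricciForm g x).flip (frame g x i)).smulRight (frame g x i)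

theorem inner_ricciOp (v w : TangentSpace I x) :
    g.inner x (ricciOp g x v) w = ricci g x v w := by
  have : ricci g x v w = ricciForm g x v w := rfl
  rw [this]
  conv_rhs => rw [← sum_inner_frame_left g x w]
  simp [ricciOp, ricciForm, g.symm x w, mul_comm]

/-- `u ↦ R(u, v) w`. -/
def riemLeft (x : M) (v w : TangentSpace I x) : TangentSpace I x →ₗ[ℝ] TangentSpace I x where
  toFun u := riem g x u v w
  map_add' u u' := riem_add_left g u u' v w
  map_smul' c u := riem_smul_left g c u v w

/-- Two traces in succession: the first makes the Ricci tensor smooth on a local frame, hence the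
Ricci operator smooth, and `τ` is the trace of that operator. -/
theorem contMDiffAt_scal : CMDiffAt ∞ (scal g) x := by
  let e := trivializationAt E (TangentSpace I : M → Type _) x
  have hx : x ∈ e.baseSet := FiberBundle.mem_baseSet_trivializationAt' x
  let b := Module.finBasis ℝ E
  have hs : ∀ y ∈ e.baseSet, ∀ i, SmoothAt (e.localFrame b i) y :=
    fun y hy i ↦ contMDiffAt_localFrame_of_mem ∞ e b i hy
  have hric : ∀ j k, CMDiffAt ∞ (fun y ↦ ricci g y (e.localFrame b j y) (e.localFrame b k y)) x :=
    fun j k ↦ contMDiffAt_trace g (fun y ↦ riemLeft g y (e.localFrame b j y) (e.localFrame b k y))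
      fun i ↦ (riem_smooth g (hs x hx i) (hs x hx j) (hs x hx k)).congr <| by
        filter_upwards [e.open_baseSet.mem_nhds hx] with y hy
        exact riem_eq g (hs y hy i) (hs y hy j) (hs y hy k)
  have hop : ∀ j, SmoothAt (fun y ↦ ricciOp g y (e.localFrame b j y)) x := fun j ↦ by
    refine smoothAt_of_inner g fun V hV ↦ ?_
    simp only [inner_ricciOp]
    refine ContMDiffAt.congr_of_eventuallyEq (f := fun y ↦ ∑ k, e.localFrameCoeff I b k y (V y)
      * ricci g y (e.localFrame b j y) (e.localFrame b k y)) ?_ ?_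
    · exact ContMDiffAt.sum fun k _ ↦ (contMDiffAt_localFrameCoeff b hx hV k).mul (hric j k)
    · filter_upwards [e.open_baseSet.mem_nhds hx] with y hy
      have h := e.eq_sum_localFrameCoeff_smul (I := I) (b := b) (s := V) hy
      have h2 := congrArg (ricciForm g y (e.localFrame b j y)) h
      rw [map_sum] at h2
      simp only [map_smul, smul_eq_mul] at h2
      exact h2
  have := contMDiffAt_trace g (fun y ↦ ricciOp g y) hop
  simp only [inner_ricciOp] at this
  exact this

end Trace

section Kahler

variable {g : Metric I M} {J : EndField I M} (hJ : IsKahler g J) {x : M}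
include hJ

theorem IsKahler.inner_left (v w : TangentSpace I x) :
    g.inner x (J x v) w = -g.inner x v (J x w) := by
  rw [← hJ.hermitian x v (J x w), hJ.sq]; simp

theorem IsKahler.inner_self (v : TangentSpace I x) : g.inner x v (J x v) = 0 := by
  have := hJ.inner_left v v
  rw [g.symm x] at this
  linarith

theorem IsKahler.smoothAt {V : Π x : M, TangentSpace I x} (hV : SmoothAt V x) :
    SmoothAt (fun y ↦ J y (V y)) x :=
  ContMDiffAt.clm_bundle_apply (F₁ := E) (F₂ := E) hJ.smooth.contMDiffAt hV

/-- `J` is parallel, so it passes through every covariant derivative in the curvature operator. -/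
theorem IsKahler.riem_right (u v w : TangentSpace I x) :
    riem g x u v (J x w) = J x (riem g x u v w) := by
  have hu := smoothAt_extend u
  have hv := smoothAt_extend v
  have hw := smoothAt_extend w
  have h1 := riem_eq g hu hv (hJ.smoothAt hw)
  have key : ∀ {X Y Z : Π x : M, TangentSpace I x}, SmoothAt X x → SmoothAt Y x → SmoothAt Z x →
      leviCivita g (fun y ↦ leviCivita g (fun z ↦ J z (Z z)) y (Y y)) x (X x) =
        J x (leviCivita g (fun y ↦ leviCivita g Z y (Y y)) x (X x)) := fun {X Y Z} hX hY hZ ↦ by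
    rw [← hJ.parallel _ _ _ (hY.leviCivita g hZ).mdiffAt]
    refine cov_congr _ (hJ.smoothAt (hY.leviCivita g hZ)) ?_ _
    filter_upwards [hZ.eventually] with y h
    exact hJ.parallel _ _ _ h
  simp only [extend_apply_self] at h1
  rw [h1]
  simp only [riem, curvature, curvatureField, key hu hv hw, key hv hu hw,
    hJ.parallel _ _ _ hw.mdiffAt, map_sub]

theorem IsKahler.riem_left (u v w : TangentSpace I x) :
    riem g x (J x u) (J x v) w = riem g x u v w := by
  refine eq_of_inner g fun z ↦ ?_
  rw [riem_pair, riem_pair g u v w, hJ.riem_right, hJ.hermitian]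

/-- `J` is an isometry, so it sends an orthonormal frame to an orthonormal frame, and the trace of a
bilinear form is the same in both. -/
theorem IsKahler.sum_frame (f : TangentSpace I x →ₗ[ℝ] TangentSpace I x →ₗ[ℝ] ℝ) :
    ∑ i, f (J x (frame g x i)) (J x (frame g x i)) = ∑ i, f (frame g x i) (frame g x i) := by
  have h : ∀ v : TangentSpace I x, ∑ i, g.inner x v (J x (frame g x i)) • J x (frame g x i) = v := by
    intro v
    have := congrArg (J x) (sum_inner_frame_left g x (J x v))
    rw [map_sum, hJ.sq, ← neg_inj, neg_neg] at this
    refine Eq.trans ?_ this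
    rw [← Finset.sum_neg_distrib]
    exact Finset.sum_congr rfl fun i _ ↦ by rw [map_smul, hJ.inner_left, neg_smul, neg_neg]
  calc ∑ i, f (J x (frame g x i)) (J x (frame g x i))
      = ∑ i, ∑ j, g.inner x (J x (frame g x i)) (frame g x j) •
          f (frame g x j) (J x (frame g x i)) := Finset.sum_congr rfl fun i _ ↦ by
        have := congrArg (fun v ↦ f v (J x (frame g x i)))
          (sum_inner_frame_left g x (J x (frame g x i)))
        simp only [map_sum, map_smul, LinearMap.sum_apply, LinearMap.smul_apply] at this
        exact this.symm
    _ = ∑ j, f (frame g x j)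
          (∑ i, g.inner x (frame g x j) (J x (frame g x i)) • J x (frame g x i)) := by
        rw [Finset.sum_comm]
        refine Finset.sum_congr rfl fun j _ ↦ ?_
        rw [map_sum]
        refine Finset.sum_congr rfl fun i _ ↦ ?_
        rw [map_smul, g.symm]
    _ = _ := Finset.sum_congr rfl fun j _ ↦ by rw [h]

theorem IsKahler.ricci_J (v w : TangentSpace I x) :
    ricci g x (J x v) (J x w) = ricci g x v w := by
  have h := hJ.sum_frame (LinearMap.mk₂ ℝ (fun u u' : TangentSpace I x ↦
    g.inner x (riem g x u v w) u') (fun u u' z ↦ by simp [riem_add_left])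
    (fun c u z ↦ by simp [riem_smul_left]) (fun u z z' ↦ by simp) (fun c u z ↦ by simp))
  simp only [LinearMap.mk₂_apply] at h
  rw [ricci, ricci, ← h]
  refine Finset.sum_congr rfl fun i _ ↦ ?_
  rw [hJ.riem_right, hJ.inner_left, ← hJ.riem_left (frame g x i), hJ.sq]
  have : riem g x (J x (frame g x i)) (-v) w = -riem g x (J x (frame g x i)) v w := by
    rw [← neg_one_smul ℝ v, riem_smul_mid, neg_one_smul]
  rw [this]; simp

end Kahler

end

/-! ### The curvature of Yano's connection -/

section

section Yano

variable (g : Metric I M) (J : EndField I M)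

/-- The difference tensor of Yano's connection, as a function of `P = grad u`. -/
def yanoForm (x : M) (P X Y : TangentSpace I x) : TangentSpace I x :=
  g.inner x P X • Y + g.inner x P Y • X - g.inner x X Y • P
    - g.inner x P (J x X) • J x Y - g.inner x P (J x Y) • J x X - g.inner x (J x X) Y • J x P

theorem yanoForm_add_right (x : M) (P X Y Y' : TangentSpace I x) :
    yanoForm g J x P X (Y + Y') = yanoForm g J x P X Y + yanoForm g J x P X Y' := by
  simp only [yanoForm, map_add]
  module

theorem yanoForm_sub_mid (x : M) (P X X' Y : TangentSpace I x) :
    yanoForm g J x P (X - X') Y = yanoForm g J x P X Y - yanoForm g J x P X' Y := by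
  simp only [yanoForm, map_sub, sub_apply]
  module

variable [FiniteDimensional ℝ E]

theorem complexConformalConnection_eq (u : M → ℝ) (Y : Π x : M, TangentSpace I x) (x : M)
    (X : TangentSpace I x) :
    complexConformalConnection g J u Y x X =
      leviCivita g Y x X + yanoForm g J x (grad g u x) X (Y x) := by
  simp only [complexConformalConnection_apply, yanoForm, inner_grad]

variable {g J} (hJ : IsKahler g J) {x : M}

theorem leviCivita_inner_smul {A B V : Π x : M, TangentSpace I x} (hA : SmoothAt A x)
    (hB : SmoothAt B x) (hV : SmoothAt V x) (v : TangentSpace I x) :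
    leviCivita g ((fun y ↦ g.inner y (A y) (B y)) • V) x v =
      g.inner x (A x) (B x) • leviCivita g V x v +
      (g.inner x (leviCivita g A x v) (B x) + g.inner x (A x) (leviCivita g B x v)) • V x := by
  rw [cov_smul _ (hA.inner g hB) hV, leviCivita_metric g v hA.mdiffAt hB.mdiffAt]

include hJ

theorem smoothAt_yanoForm {P X Y : Π x : M, TangentSpace I x} (hP : SmoothAt P x)
    (hX : SmoothAt X x) (hY : SmoothAt Y x) :
    SmoothAt (fun y ↦ yanoForm g J y (P y) (X y) (Y y)) x := by
  have hJX := hJ.smoothAt hX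
  have hJY := hJ.smoothAt hY
  exact (((((hY.smul (hP.inner g hX)).add (hX.smul (hP.inner g hY))).sub
    (hP.smul (hX.inner g hY))).sub (hJY.smul (hP.inner g hJX))).sub
    (hJX.smul (hP.inner g hJY))).sub ((hJ.smoothAt hP).smul (hJX.inner g hY))

/-- `yanoForm` is built from `g` and `J` alone and both are parallel, so only its three arguments
get differentiated. -/
theorem leviCivita_yanoForm {P X Y : Π x : M, TangentSpace I x} (hP : SmoothAt P x)
    (hX : SmoothAt X x) (hY : SmoothAt Y x) (v : TangentSpace I x) :
    leviCivita g (fun y ↦ yanoForm g J y (P y) (X y) (Y y)) x v =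
      yanoForm g J x (leviCivita g P x v) (X x) (Y x)
      + yanoForm g J x (P x) (leviCivita g X x v) (Y x)
      + yanoForm g J x (P x) (X x) (leviCivita g Y x v) := by
  have hJX := hJ.smoothAt hX
  have hJY := hJ.smoothAt hY
  have hJP := hJ.smoothAt hP
  have t1 := hY.smul (hP.inner g hX)
  have t2 := hX.smul (hP.inner g hY)
  have t3 := hP.smul (hX.inner g hY)
  have t4 := hJY.smul (hP.inner g hJX)
  have t5 := hJX.smul (hP.inner g hJY)
  have t6 := hJP.smul (hJX.inner g hY)
  have e : (fun y ↦ yanoForm g J y (P y) (X y) (Y y)) =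
      (fun y ↦ g.inner y (P y) (X y)) • Y + (fun y ↦ g.inner y (P y) (Y y)) • X
      - (fun y ↦ g.inner y (X y) (Y y)) • P
      - (fun y ↦ g.inner y (P y) (J y (X y))) • (fun y ↦ J y (Y y))
      - (fun y ↦ g.inner y (P y) (J y (Y y))) • (fun y ↦ J y (X y))
      - (fun y ↦ g.inner y (J y (X y)) (Y y)) • (fun y ↦ J y (P y)) := rfl
  rw [e, cov_sub _ ((((t1.add t2).sub t3).sub t4).sub t5) t6, cov_sub _ (((t1.add t2).sub t3).sub t4) t5,
    cov_sub _ ((t1.add t2).sub t3) t4, cov_sub _ (t1.add t2) t3, cov_add _ t1 t2,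
    leviCivita_inner_smul hP hX hY, leviCivita_inner_smul hP hY hX, leviCivita_inner_smul hX hY hP,
    leviCivita_inner_smul hP hJX hJY, leviCivita_inner_smul hP hJY hJX,
    leviCivita_inner_smul hJX hY hJP, hJ.parallel _ _ _ hX.mdiffAt, hJ.parallel _ _ _ hY.mdiffAt,
    hJ.parallel _ _ _ hP.mdiffAt]
  simp only [yanoForm]
  module

/-- The curvature of Yano's complex conformal connection. -/
theorem curvature_complexConformalConnection {u : M → ℝ} (hu : CMDiffAt ∞ u x)
    (X Y Z : TangentSpace I x) :
    curvature (complexConformalConnection g J u) x X Y Z = riem g x X Y Z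
      + (yanoForm g J x (leviCivita g (grad g u) x X) Y Z
        - yanoForm g J x (leviCivita g (grad g u) x Y) X Z
        + yanoForm g J x (grad g u x) X (yanoForm g J x (grad g u x) Y Z)
        - yanoForm g J x (grad g u x) Y (yanoForm g J x (grad g u x) X Z)) := by
  have hX := smoothAt_extend X
  have hY := smoothAt_extend Y
  have hZ := smoothAt_extend Z
  have hP := smoothAt_grad g hu
  -- Under exchange of `X` and `Y` the terms with `∇Z` cancel, and those with `∇_X Y - ∇_Y X` are
  -- absorbed by the bracket because `∇` is torsion free. What survives involves `∇P` and quadratic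
  -- terms in `P` only.
  have key : ∀ {X Y Z : Π x : M, TangentSpace I x}, SmoothAt X x → SmoothAt Y x → SmoothAt Z x →
      complexConformalConnection g J u (fun y ↦ complexConformalConnection g J u Z y (Y y)) x (X x) =
      leviCivita g (fun y ↦ leviCivita g Z y (Y y)) x (X x)
      + (yanoForm g J x (leviCivita g (grad g u) x (X x)) (Y x) (Z x)
      + yanoForm g J x (grad g u x) (leviCivita g Y x (X x)) (Z x)
      + yanoForm g J x (grad g u x) (Y x) (leviCivita g Z x (X x)))
      + yanoForm g J x (grad g u x) (X x) (leviCivita g Z x (Y x))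
      + yanoForm g J x (grad g u x) (X x) (yanoForm g J x (grad g u x) (Y x) (Z x)) :=
    fun {X Y Z} hX hY hZ ↦ by
    have e : (fun y ↦ complexConformalConnection g J u Z y (Y y)) =
        (fun y ↦ leviCivita g Z y (Y y)) +
          fun y ↦ yanoForm g J y (grad g u y) (Y y) (Z y) :=
      funext fun y ↦ complexConformalConnection_eq ..
    rw [complexConformalConnection_eq, e, cov_add _ (hY.leviCivita g hZ)
      (smoothAt_yanoForm hJ hP hY hZ), leviCivita_yanoForm hJ hP hY hZ, complexConformalConnection_eq,
      yanoForm_add_right]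
    abel
  rw [curvature, curvatureField, key hX hY hZ, key hY hX hZ, complexConformalConnection_eq,
    mlieBracket_eq g hX hY, yanoForm_sub_mid, map_sub, riem, curvature, curvatureField,
    mlieBracket_eq g hX hY, map_sub]
  simp only [extend_apply_self]
  abel

end Yano

end

/-! ### The Hessian forced by flatness -/

section

variable [FiniteDimensional ℝ E]

/-- The tensor `Φ` built from an arbitrary vector `ξ`, with `η = g(ξ, ·)`. -/
def phiForm (g : Metric I M) (J : EndField I M) (x : M) (ξ u v w : TangentSpace I x) :
    TangentSpace I x :=
  (1 / 8 : ℝ) •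
    (g.inner x v w • (g.inner x ξ u • ξ - g.inner x ξ (J x u) • J x ξ)
      - g.inner x u w • (g.inner x ξ v • ξ - g.inner x ξ (J x v) • J x ξ)
      + g.inner x (J x v) w • (g.inner x ξ u • J x ξ + g.inner x ξ (J x u) • ξ)
      - g.inner x (J x u) w • (g.inner x ξ v • J x ξ + g.inner x ξ (J x v) • ξ)
      - (2 * g.inner x (J x u) v) • (g.inner x ξ w • J x ξ + g.inner x ξ (J x w) • ξ)
      + (g.inner x ξ v * g.inner x ξ w + g.inner x ξ (J x v) * g.inner x ξ (J x w)) • u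
      - (g.inner x ξ u * g.inner x ξ w + g.inner x ξ (J x u) * g.inner x ξ (J x w)) • v
      - (g.inner x ξ v * g.inner x ξ (J x w) - g.inner x ξ (J x v) * g.inner x ξ w) • J x u
      + (g.inner x ξ u * g.inner x ξ (J x w) - g.inner x ξ (J x u) * g.inner x ξ w) • J x v
      + (2 * (g.inner x ξ u * g.inner x ξ (J x v) - g.inner x ξ (J x u) * g.inner x ξ v)) • J x w)

theorem phiTensor_eq (g : Metric I M) (J : EndField I M) (x : M) (u v w : TangentSpace I x) :
    phiTensor g J x u v w = phiForm g J x (xi g x) u v w :=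
  rfl

omit [FiniteDimensional ℝ E] in
theorem phiForm_smul (g : Metric I M) (J : EndField I M) (x : M) (t : ℝ)
    (ξ u v w : TangentSpace I x) :
    phiForm g J x (t • ξ) u v w = t ^ 2 • phiForm g J x ξ u v w := by
  simp only [phiForm, map_smul, smul_apply, smul_eq_mul]
  module

section Algebra

variable {g : Metric I M} {x : M}

/-- Fewer than `dim M` vectors have a common nonzero orthogonal vector. -/
theorem exists_orthogonal (g : Metric I M) {m : ℕ} (hm : m < Module.finrank ℝ E)
    (s : Fin m → TangentSpace I x) : ∃ v : TangentSpace I x, v ≠ 0 ∧ ∀ i, g.inner x (s i) v = 0 := by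
  let L : TangentSpace I x →ₗ[ℝ] (Fin m → ℝ) :=
    LinearMap.pi fun i ↦ (g.inner x (s i)).toLinearMap
  have h : Module.finrank ℝ (Fin m → ℝ) < Module.finrank ℝ (TangentSpace I x) := by
    rw [Module.finrank_fin_fun]; exact hm
  obtain ⟨v, hv, h0⟩ := (Submodule.ne_bot_iff _).1 (LinearMap.ker_ne_bot_of_finrank_lt (f := L) h)
  exact ⟨v, h0, fun i ↦ congrFun (LinearMap.mem_ker.1 hv) i⟩

variable {J : EndField I M} (hJ : IsKahler g J)
include hJ

theorem IsKahler.inner_comm (v w : TangentSpace I x) :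
    g.inner x v (J x w) = -g.inner x w (J x v) := by
  rw [g.symm x v, hJ.inner_left]

/-- The part of `yanoForm` that is skew in its last two arguments is `-2 g(JX,Y) JP`, so the
symmetric terms disappear from the cyclic sum. No symmetry of `h` enters. -/
theorem yanoForm_cyclic (h : TangentSpace I x → TangentSpace I x) (P X Y Z : TangentSpace I x) :
    (yanoForm g J x (h X) Y Z - yanoForm g J x (h Y) X Z
      + yanoForm g J x P X (yanoForm g J x P Y Z) - yanoForm g J x P Y (yanoForm g J x P X Z))
    + (yanoForm g J x (h Y) Z X - yanoForm g J x (h Z) Y X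
      + yanoForm g J x P Y (yanoForm g J x P Z X) - yanoForm g J x P Z (yanoForm g J x P Y X))
    + (yanoForm g J x (h Z) X Y - yanoForm g J x (h X) Z Y
      + yanoForm g J x P Z (yanoForm g J x P X Y) - yanoForm g J x P X (yanoForm g J x P Z Y)) =
    (-2 * g.inner x (J x X) Y) •
        (J x (h Z) + (2 * g.inner x P (J x Z)) • P + g.inner x P P • J x Z)
    + (-2 * g.inner x (J x Y) Z) •
        (J x (h X) + (2 * g.inner x P (J x X)) • P + g.inner x P P • J x X)
    + (-2 * g.inner x (J x Z) X) •
        (J x (h Y) + (2 * g.inner x P (J x Y)) • P + g.inner x P P • J x Y) := by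
  simp only [yanoForm, map_add, map_sub, map_neg, map_smul, hJ.inner_left, hJ.sq, smul_eq_mul,
    hJ.inner_self, g.symm x X P,
    g.symm x Y P, g.symm x Z P, g.symm x Y X, g.symm x Z X, g.symm x Z Y, hJ.inner_comm X P,
    hJ.inner_comm Y P, hJ.inner_comm Z P, hJ.inner_comm Y X, hJ.inner_comm Z X, hJ.inner_comm Z Y]
  module

theorem yanoForm_eq_curvatureForm {P : TangentSpace I x}
    {h : TangentSpace I x → TangentSpace I x}
    (hh : ∀ v, h v = -(g.inner x P P) • v + (2 * g.inner x P (J x v)) • J x P)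
    (X Y Z : TangentSpace I x) :
    yanoForm g J x (h X) Y Z - yanoForm g J x (h Y) X Z
      + yanoForm g J x P X (yanoForm g J x P Y Z) - yanoForm g J x P Y (yanoForm g J x P X Z) =
    (4 * g.inner x P P) • piTensor g J x X Y Z + (8 : ℝ) • phiForm g J x P X Y Z := by
  simp only [yanoForm, piTensor, phiForm, hh, map_add, map_sub, map_neg, map_smul, add_apply,
    smul_apply, hJ.inner_left, hJ.sq, smul_eq_mul,
    hJ.inner_self, g.symm x X P, g.symm x Y P, g.symm x Y X,
    hJ.inner_comm X P, hJ.inner_comm Y P, hJ.inner_comm Y X]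
  module

/-- In a flat connection the cyclic sum of the added terms equals minus that of `R`, which is zero.
A test triple `X, JX, v` with `X` orthogonal to `v` and `Jv` isolates one of its three brackets. -/
theorem hess_of_flat {u : M → ℝ} (hu : CMDiffAt ∞ u x) (hdim : 2 < Module.finrank ℝ E)
    (hflat : ∀ X Y Z : TangentSpace I x, curvature (complexConformalConnection g J u) x X Y Z = 0)
    (v : TangentSpace I x) :
    leviCivita g (grad g u) x v = -(g.inner x (grad g u x) (grad g u x)) • v
      + (2 * g.inner x (grad g u x) (J x v)) • J x (grad g u x) := by
  obtain ⟨X, hX, hXv⟩ := exists_orthogonal g hdim ![v, J x v]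
  have h0 : g.inner x v X = 0 := hXv 0
  have h1 : g.inner x (J x v) X = 0 := hXv 1
  have key := yanoForm_cyclic hJ (fun v ↦ leviCivita g (grad g u) x v) (grad g u x) X (J x X) v
  have f := fun X Y Z ↦ eq_neg_of_add_eq_zero_right
    ((curvature_complexConformalConnection hJ hu X Y Z).symm.trans (hflat X Y Z))
  rw [f, f, f, ← neg_add, ← neg_add, riem_bianchi, neg_zero, hJ.hermitian, h1, hJ.sq] at key
  have h2 : g.inner x (-X) v = 0 := by rw [g.symm, map_neg, h0, neg_zero]
  rw [h2, mul_zero, zero_smul, zero_smul, add_zero, add_zero, eq_comm, smul_eq_zero] at key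
  -- Only the bracket in `v` remains, with coefficient `-2|X|² ≠ 0`; applying `J` to it solves for
  -- `∇_v P`.
  have h3 := key.resolve_left (mul_ne_zero (by norm_num) (g.pos x X hX).ne')
  have h4 := congrArg (J x) h3
  simp only [map_add, map_smul, hJ.sq, map_zero] at h4
  rw [← sub_eq_zero] at h4 ⊢
  rw [← neg_eq_zero]
  refine Eq.trans ?_ h4
  module

theorem curvature_eq_of_hess {u : M → ℝ} (hu : CMDiffAt ∞ u x)
    (hh : ∀ v, leviCivita g (grad g u) x v = -(g.inner x (grad g u x) (grad g u x)) • v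
      + (2 * g.inner x (grad g u x) (J x v)) • J x (grad g u x))
    (X Y Z : TangentSpace I x) :
    curvature (complexConformalConnection g J u) x X Y Z = riem g x X Y Z +
      ((4 * g.inner x (grad g u x) (grad g u x)) • piTensor g J x X Y Z
        + (8 : ℝ) • phiForm g J x (grad g u x) X Y Z) := by
  rw [curvature_complexConformalConnection hJ hu,
    ← yanoForm_eq_curvatureForm hJ (h := fun v ↦ leviCivita g (grad g u) x v) hh]

end Algebra

end

/-! ### Contractions of the curvature form `aπ + bΦ` -/

section

variable [FiniteDimensional ℝ E]

section Traces

theorem sum_inner_mul_inner (g : Metric I M) {x : M} (v w : TangentSpace I x) :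
    ∑ i, g.inner x v (frame g x i) * g.inner x w (frame g x i) = g.inner x v w := by
  conv_rhs => rw [← sum_inner_frame_left g x w]
  simp only [map_sum, map_smul, smul_eq_mul, mul_comm]

theorem sum_inner_self (g : Metric I M) (x : M) :
    ∑ i, g.inner x (frame g x i) (frame g x i) = Module.finrank ℝ E := by
  simp [inner_frame]

variable {g : Metric I M} {x : M} {J : EndField I M} (hJ : IsKahler g J)
include hJ

theorem inner_piTensor_self (e v w : TangentSpace I x) :
    g.inner x (piTensor g J x e v w) e = (1 / 4) * (g.inner x v w * g.inner x e e
      - g.inner x w e * g.inner x v e + 3 * (g.inner x (J x v) e * g.inner x (J x w) e)) := by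
  simp only [piTensor, map_add, map_sub, map_smul, add_apply, sub_apply, smul_apply, smul_eq_mul,
    hJ.inner_left, hJ.inner_self, g.symm x e w, hJ.inner_comm e v, hJ.inner_comm e w]
  ring

/-- Every term is arranged as a product of two pairings with `e`, or as a multiple of `g(e,e)`, so
that summation over a frame is Parseval's identity. -/
theorem inner_phiForm_self (ξ e v w : TangentSpace I x) :
    g.inner x (phiForm g J x ξ e v w) e = (1 / 8) * (
      g.inner x v w * (g.inner x ξ e * g.inner x ξ e + g.inner x (J x ξ) e * g.inner x (J x ξ) e)
      + (g.inner x ξ v * g.inner x ξ w + g.inner x ξ (J x v) * g.inner x ξ (J x w)) *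
        g.inner x e e
      - g.inner x ξ v * (g.inner x w e * g.inner x ξ e)
      + g.inner x ξ (J x v) * (g.inner x w e * g.inner x (J x ξ) e)
      + g.inner x ξ v * (g.inner x (J x w) e * g.inner x (J x ξ) e)
      + 3 * g.inner x ξ (J x v) * (g.inner x (J x w) e * g.inner x ξ e)
      + 3 * g.inner x ξ w * (g.inner x (J x v) e * g.inner x (J x ξ) e)
      + 3 * g.inner x ξ (J x w) * (g.inner x (J x v) e * g.inner x ξ e)
      - g.inner x ξ w * (g.inner x v e * g.inner x ξ e)
      + g.inner x ξ (J x w) * (g.inner x v e * g.inner x (J x ξ) e)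
      + 2 * g.inner x ξ v * (g.inner x (J x w) e * g.inner x (J x ξ) e)) := by
  simp only [phiForm, map_add, map_sub, map_smul, add_apply, sub_apply, smul_apply, smul_eq_mul,
    hJ.inner_left, hJ.inner_self, g.symm x e w, hJ.inner_comm e v, hJ.inner_comm e w]
  ring

/-- Substituting this `Q` into the Bochner formula reproduces `aπ + bΦ`. If `R` is known this yields
vanishing of the Bochner tensor; if the Bochner tensor vanishes it yields `R`. -/
theorem bochnerTensor_of_bochnerQ {a b : ℝ} {ξ : TangentSpace I x} {n : ℕ}
    (hQ : ∀ v w, bochnerQ n g x v w = a / 8 * g.inner x v w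
      + b / 8 * (g.inner x ξ v * g.inner x ξ w + g.inner x ξ (J x v) * g.inner x ξ (J x w)))
    (u v w : TangentSpace I x) : bochnerTensor n g J x u v w =
      riem g x u v w - (a • piTensor g J x u v w + b • phiForm g J x ξ u v w) := by
  have hQop : ∀ v, bochnerQOp n g x v = (a / 8) • v
      + (b / 8) • (g.inner x ξ v • ξ - g.inner x ξ (J x v) • J x ξ) := by
    intro v
    have h : ∀ e, g.inner x ξ (J x e) = -g.inner x (J x ξ) e := fun e ↦ by
      rw [hJ.inner_left, neg_neg]
    rw [← sum_inner_frame_left g x ((a / 8) • v + _)]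
    refine Finset.sum_congr rfl fun i _ ↦ ?_
    rw [hQ, h (frame g x i)]
    congr 1
    simp only [map_add, map_sub, map_smul, add_apply, sub_apply, smul_apply, smul_eq_mul]
    ring
  simp only [bochnerTensor, piTensor, phiForm, hQ, hQop, map_add, map_sub, map_neg, map_smul,
    hJ.inner_left, hJ.sq]
  module

variable {a b : ℝ} {ξ : TangentSpace I x} {n : ℕ} (hn : Module.finrank ℝ E = 2 * n)
  (hR : ∀ u v w, riem g x u v w = a • piTensor g J x u v w + b • phiForm g J x ξ u v w)
include hn hR

theorem ricci_of_curvatureForm (v w : TangentSpace I x) :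
    ricci g x v w = ((2 * n + 2) * a + b * g.inner x ξ ξ) / 4 * g.inner x v w
      + (n + 2) * b / 4 * (g.inner x ξ v * g.inner x ξ w + g.inner x ξ (J x v) * g.inner x ξ (J x w))
    := by
  simp only [ricci, hR, map_add, map_smul, add_apply, smul_apply, smul_eq_mul,
    inner_piTensor_self hJ, inner_phiForm_self hJ, mul_add, mul_sub, Finset.sum_add_distrib,
    Finset.sum_sub_distrib, ← Finset.mul_sum, sum_inner_mul_inner, sum_inner_self, hn]
  simp only [hJ.hermitian, hJ.inner_left, g.symm x v ξ, g.symm x w ξ, g.symm x w v,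
    hJ.inner_comm v ξ, hJ.inner_comm w ξ]
  push_cast
  ring

theorem scal_of_curvatureForm : scal g x = (n + 1) * (n * a + b * g.inner x ξ ξ) := by
  have h : ∀ e, g.inner x ξ (J x e) = -g.inner x (J x ξ) e := fun e ↦ by
    rw [hJ.inner_left, neg_neg]
  simp only [scal, ricci_of_curvatureForm hJ hn hR, h, neg_mul_neg, Finset.sum_add_distrib,
    ← Finset.mul_sum, sum_inner_mul_inner, sum_inner_self, hn, hJ.hermitian]
  push_cast
  ring

/-- For `ξ ≠ 0` the Ricci operator has eigenvalue `α` on the complement of `ξ, Jξ` and `α + β|ξ|²`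
on their span, so the value is `(2n-2)α² + 2(α + β|ξ|²)²`. -/
theorem ricciNormSq_of_curvatureForm {α β : ℝ}
    (hα : α = ((2 * n + 2) * a + b * g.inner x ξ ξ) / 4) (hβ : β = (n + 2) * b / 4) :
    ricciNormSq g x = 2 * n * α ^ 2 + 4 * α * β * g.inner x ξ ξ + 2 * β ^ 2 * g.inner x ξ ξ ^ 2 := by
  have h : ∀ e, g.inner x ξ (J x e) = -g.inner x (J x ξ) e := fun e ↦ by
    rw [hJ.inner_left, neg_neg]
  have h1 : ∀ i, ∑ j, ricci g x (frame g x i) (frame g x j) ^ 2 =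
      α ^ 2 + 2 * α * β * (g.inner x ξ (frame g x i) * g.inner x ξ (frame g x i)
        + g.inner x (J x ξ) (frame g x i) * g.inner x (J x ξ) (frame g x i))
      + β ^ 2 * (g.inner x ξ (frame g x i) * g.inner x ξ (frame g x i)
        + g.inner x (J x ξ) (frame g x i) * g.inner x (J x ξ) (frame g x i)) * g.inner x ξ ξ := by
    intro i
    set e := frame g x i
    have h2 : ∀ j, ricci g x e (frame g x j) ^ 2 =
      α ^ 2 * (g.inner x e (frame g x j) * g.inner x e (frame g x j))
      + (2 * α * β * g.inner x ξ e) * (g.inner x e (frame g x j) * g.inner x ξ (frame g x j))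
      + (2 * α * β * g.inner x (J x ξ) e) *
        (g.inner x e (frame g x j) * g.inner x (J x ξ) (frame g x j))
      + (β ^ 2 * g.inner x ξ e ^ 2) * (g.inner x ξ (frame g x j) * g.inner x ξ (frame g x j))
      + (2 * β ^ 2 * g.inner x ξ e * g.inner x (J x ξ) e) *
        (g.inner x ξ (frame g x j) * g.inner x (J x ξ) (frame g x j))
      + (β ^ 2 * g.inner x (J x ξ) e ^ 2) *
        (g.inner x (J x ξ) (frame g x j) * g.inner x (J x ξ) (frame g x j)) := by
      intro j
      rw [ricci_of_curvatureForm hJ hn hR, ← hα, ← hβ, h, h]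
      ring
    have h3 : g.inner x e e = 1 := by simp [e, inner_frame]
    simp only [h2, Finset.sum_add_distrib, ← Finset.mul_sum, sum_inner_mul_inner, hJ.hermitian,
      hJ.inner_self, h3]
    rw [g.symm x e ξ, g.symm x e (J x ξ)]
    ring
  simp only [ricciNormSq, h1, Finset.sum_add_distrib, ← Finset.mul_sum, ← Finset.sum_mul,
    sum_inner_mul_inner, hJ.hermitian, Finset.sum_const, Finset.card_univ, Fintype.card_fin, hn,
    nsmul_eq_mul]
  push_cast
  ring

theorem bochnerQ_of_curvatureForm (v w : TangentSpace I x) :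
    bochnerQ n g x v w = a / 8 * g.inner x v w
      + b / 8 * (g.inner x ξ v * g.inner x ξ w + g.inner x ξ (J x v) * g.inner x ξ (J x w)) := by
  rw [bochnerQ, scal_of_curvatureForm hJ hn hR, ricci_of_curvatureForm hJ hn hR]
  field_simp
  ring

theorem bochnerTensor_of_curvatureForm (u v w : TangentSpace I x) :
    bochnerTensor n g J x u v w = 0 := by
  rw [bochnerTensor_of_bochnerQ hJ (bochnerQ_of_curvatureForm hJ hn hR), hR, sub_self]

end Traces

end

/-! ### Scalar chain rule and functions with zero differential -/

section Calculus

omit [IsManifold I ∞ M] in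
theorem mvfderiv_real_comp {φ : ℝ → ℝ} {f : M → ℝ} {x : M} {c : ℝ} (hφ : HasDerivAt φ c (f x))
    (hf : MDiffAt f x) (v : TangentSpace I x) :
    mvfderiv I (fun y ↦ φ (f y)) x v = c * mvfderiv I f x v := by
  have h := (hφ.hasFDerivAt.hasMFDerivAt.comp x hf.hasMFDerivAt).mfderiv
  have h1 : mvfderiv I (fun y ↦ φ (f y)) x v = (mfderiv I 𝓘(ℝ, ℝ) (φ ∘ f) x v : ℝ) := rfl
  rw [h1, h]
  exact mul_comm (mvfderiv I f x v) c

/-- A smooth function whose differential vanishes on a connected component is constant there. -/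
theorem eq_of_mvfderiv_eq_zero {M : Type*} [TopologicalSpace M] [ChartedSpace E M]
    [IsManifold 𝓘(ℝ, E) ∞ M] {f : M → ℝ} (hf : ContMDiff 𝓘(ℝ, E) 𝓘(ℝ, ℝ) ∞ f) {x y : M}
    (h0 : ∀ z ∈ connectedComponent x, mvfderiv 𝓘(ℝ, E) f z = 0) (hy : y ∈ connectedComponent x) :
    f y = f x := by
  have : LocallyConnectedSpace M := ChartedSpace.locallyConnectedSpace E M
  have hopen : IsOpen (connectedComponent x) := isOpen_connectedComponent
  -- Local constancy: in a chart, a ball that stays inside the component is convex, and the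
  -- coordinate expression of `f` has zero derivative on it.
  have key : ∀ z ∈ connectedComponent x, ∀ᶠ w in 𝓝 z, f w = f z := by
    intro z hz
    let c := chartAt E z
    have hz' : z ∈ c.source := mem_chart_source E z
    have ho : IsOpen (c.target ∩ c.symm ⁻¹' connectedComponent x) :=
      c.isOpen_inter_preimage_symm hopen
    obtain ⟨r, hr, hball⟩ := Metric.isOpen_iff.1 ho (c z)
      ⟨c.map_source hz', by rwa [Set.mem_preimage, c.left_inv hz']⟩
    have hd : ∀ w ∈ Metric.ball (c z) r, HasFDerivAt (f ∘ c.symm) (0 : E →L[ℝ] ℝ) w := by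
      intro w hw
      have h1 : MDifferentiableAt 𝓘(ℝ, E) 𝓘(ℝ, E) c.symm w :=
        mdifferentiableAt_atlas_symm (chart_mem_atlas E z) (hball hw).1
      have h2 : MDifferentiableAt 𝓘(ℝ, E) 𝓘(ℝ, ℝ) f (c.symm w) :=
        hf.mdifferentiableAt (by simp)
      have h3 := (h2.comp w h1).differentiableAt
      have h4 := mvfderiv_comp (I' := 𝓘(ℝ, E)) (I := 𝓘(ℝ, E)) (g := f) (f := c.symm) w h2 h1
      rw [h0 _ (hball hw).2] at h4
      have h5 : fderiv ℝ (f ∘ c.symm) w = 0 := by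
        rw [← mfderiv_eq_fderiv]
        refine ContinuousLinearMap.ext fun v ↦ ?_
        exact DFunLike.congr_fun h4 v
      rw [← h5]
      exact h3.hasFDerivAt
    have hc : c.source ∩ c ⁻¹' Metric.ball (c z) r ∈ 𝓝 z :=
      (c.isOpen_inter_preimage Metric.isOpen_ball).mem_nhds ⟨hz', Metric.mem_ball_self hr⟩
    filter_upwards [hc] with w hw
    have := Metric.isOpen_ball.is_const_of_fderiv_eq_zero (𝕜 := ℝ)
      (convex_ball (c z) r).isPreconnected (f := f ∘ c.symm)
      (fun w hw ↦ (hd w hw).differentiableAt.differentiableWithinAt)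
      (fun w hw ↦ (hd w hw).fderiv) hw.2 (Metric.mem_ball_self hr)
    simpa [c.left_inv hw.1, c.left_inv hz'] using this
  have hl : IsLocallyConstant (fun z : connectedComponent x ↦ f z) := by
    rw [IsLocallyConstant.iff_eventually_eq]
    rintro ⟨z, hz⟩
    exact continuous_subtype_val.continuousAt.eventually 
      (p := fun w ↦ f w = f z) (key z hz)
  exact hl.apply_eq_of_isPreconnected (s := Set.univ)
    (isPreconnected_iff_preconnectedSpace.1 isPreconnected_connectedComponent).isPreconnected_univ
    (x := ⟨y, hy⟩) (y := ⟨x, mem_connectedComponent⟩) trivial trivial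

end Calculus

/-! ### From a flat connection to the special Bochner-Kähler conditions -/

section

variable [FiniteDimensional ℝ E]

theorem mvfderiv_inner_self (g : Metric I M) {V : Π x : M, TangentSpace I x} {x : M}
    (hV : MDiffAt (T% V) x) (v : TangentSpace I x) :
    mvfderiv I (fun y ↦ g.inner y (V y) (V y)) x v = 2 * g.inner x (leviCivita g V x v) (V x) := by
  rw [leviCivita_metric g v hV hV, g.symm x (V x)]
  ring

theorem grad_ne_zero_iff (g : Metric I M) {f : M → ℝ} {x : M} :
    grad g f x ≠ 0 ↔ mvfderiv I f x ≠ 0 := by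
  refine not_congr ⟨fun h ↦ ContinuousLinearMap.ext fun v ↦ ?_, fun h ↦ ?_⟩
  · rw [← inner_grad g, h, map_zero]
  · simp [grad, h]

theorem xi_eq (g : Metric I M) {x : M} {c : ℝ} {P : TangentSpace I x} (hc : 0 < c)
    (h : grad g (scal g) x = c • P) : xi g x = (√(g.inner x P P))⁻¹ • P := by
  have h1 : g.inner x (c • P) (c • P) = c ^ 2 * g.inner x P P := by
    simp only [map_smul, smul_apply, smul_eq_mul]; ring
  rw [xi, h, h1, Real.sqrt_mul (sq_nonneg c), Real.sqrt_sq hc.le, smul_smul, mul_inv, mul_comm c⁻¹,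
    mul_assoc, inv_mul_cancel₀ hc.ne', mul_one]

section Flat

variable {g : Metric I M} {J : EndField I M} (hJ : IsKahler g J) {u : M → ℝ}
  (hu : ContMDiff I 𝓘(ℝ, ℝ) ∞ u) (hdim : 2 < Module.finrank ℝ E)
  (hflat : IsFlat (complexConformalConnection g J u))
include hJ hu hdim hflat

/-- The `JP` term of the Hessian is orthogonal to `P`. The result says `d|P|² = -2|P|² du`, so `|P|²
e^{2u}` is locally constant. -/
theorem mvfderiv_norm_grad_of_flat (x : M) (v : TangentSpace I x) :
    mvfderiv I (fun y ↦ g.inner y (grad g u y) (grad g u y)) x v =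
      -2 * g.inner x (grad g u x) (grad g u x) * g.inner x (grad g u x) v := by
  rw [mvfderiv_inner_self g (smoothAt_grad g hu.contMDiffAt).mdiffAt,
    hess_of_flat hJ hu.contMDiffAt hdim (hflat x)]
  simp only [map_add, map_smul, add_apply, smul_apply, smul_eq_mul, hJ.inner_left,
    hJ.inner_self, g.symm x v]
  ring

/-- Stated with `P` itself rather than a unit vector, so it also holds where `P` vanishes. -/
theorem riem_of_flat (x : M) (X Y Z : TangentSpace I x) :
    riem g x X Y Z = (-(4 * g.inner x (grad g u x) (grad g u x))) • piTensor g J x X Y Z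
        + (-8 : ℝ) • phiForm g J x (grad g u x) X Y Z := by
  have h := curvature_eq_of_hess hJ hu.contMDiffAt
    (hess_of_flat hJ hu.contMDiffAt hdim (hflat x)) X Y Z
  rw [hflat, eq_comm, add_eq_zero_iff_eq_neg] at h
  rw [h]
  module

variable {n : ℕ} (hn : Module.finrank ℝ E = 2 * n)
include hn

theorem scal_of_flat : scal g =
    fun x ↦ -(4 * (n + 1) * (n + 2)) * g.inner x (grad g u x) (grad g u x) := by
  funext x
  rw [scal_of_curvatureForm hJ hn (riem_of_flat hJ hu hdim hflat x)]
  ring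

theorem grad_scal_of_flat (x : M) : grad g (scal g) x =
    (8 * (n + 1) * (n + 2) * g.inner x (grad g u x) (grad g u x)) • grad g u x := by
  refine eq_of_inner g fun v ↦ ?_
  have hs : MDiffAt (fun y ↦ g.inner y (grad g u y) (grad g u y)) x :=
    mdiffAt_inner g (smoothAt_grad g hu.contMDiffAt).mdiffAt
      (smoothAt_grad g hu.contMDiffAt).mdiffAt
  rw [inner_grad, scal_of_flat hJ hu hdim hflat hn,
    mvfderiv_real_comp (φ := fun t ↦ -(4 * (n + 1) * (n + 2)) * t)
      ((hasDerivAt_id _).const_mul _) hs, mvfderiv_norm_grad_of_flat hJ hu hdim hflat]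
  simp only [map_smul, smul_apply, smul_eq_mul]
  ring

theorem laplacian_scal_of_flat (x : M) : laplacian g (scal g) x =
    -(16 * (n + 1) * (n + 2) ^ 2) * g.inner x (grad g u x) (grad g u x) ^ 2 := by
  have hP : SmoothAt (grad g u) x := smoothAt_grad g hu.contMDiffAt
  have hs := hP.inner g hP
  have h : ∀ e, g.inner x (leviCivita g (grad g (scal g)) x e) e =
      8 * (n + 1) * (n + 2) * g.inner x (grad g u x) (grad g u x) *
        (-(g.inner x (grad g u x) (grad g u x)) * g.inner x e e
          - 2 * (g.inner x (grad g u x) e * g.inner x (grad g u x) e)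
          - 2 * (g.inner x (J x (grad g u x)) e * g.inner x (J x (grad g u x)) e)) := by
    intro e
    have hc : CMDiffAt ∞ (fun y ↦ 8 * (n + 1) * (n + 2) * g.inner y (grad g u y) (grad g u y)) x :=
      contMDiffAt_const.mul hs
    rw [funext (grad_scal_of_flat hJ hu hdim hflat hn)]
    have := cov_smul (leviCivita g) hc hP e
    rw [show (fun y ↦ (8 * (n + 1) * (n + 2) * g.inner y (grad g u y) (grad g u y)) • grad g u y)
      = (fun y ↦ 8 * (n + 1) * (n + 2) * g.inner y (grad g u y) (grad g u y)) • grad g u from rfl,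
      this, mvfderiv_real_comp (φ := fun t ↦ 8 * (n + 1) * (n + 2) * t)
      ((hasDerivAt_id _).const_mul _) (hs.mdifferentiableAt (by simp)),
      mvfderiv_norm_grad_of_flat hJ hu hdim hflat, hess_of_flat hJ hu.contMDiffAt hdim (hflat x)]
    simp only [map_add, map_smul, add_apply, smul_apply, smul_eq_mul, hJ.inner_left]
    ring
  simp only [laplacian, h, ← Finset.mul_sum, Finset.sum_sub_distrib, sum_inner_mul_inner,
    sum_inner_self, hn, hJ.hermitian]
  push_cast
  ring

/-- In units of `8(n+2)²|P|⁴` the three summands are `n+3`, `-(n+1)` and `-2`. -/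
theorem bochnerConst_of_flat (x : M) : bochnerConst n g x = 0 := by
  rw [bochnerConst, laplacian_scal_of_flat hJ hu hdim hflat hn, scal_of_flat hJ hu hdim hflat hn,
    ricciNormSq_of_curvatureForm hJ hn (riem_of_flat hJ hu hdim hflat x) rfl rfl]
  field_simp
  ring

theorem xi_of_flat {x : M} (hx : grad g u x ≠ 0) :
    xi g x = (√(g.inner x (grad g u x) (grad g u x)))⁻¹ • grad g u x := by
  have := g.pos x _ hx
  exact xi_eq g (by positivity) (grad_scal_of_flat hJ hu hdim hflat hn x)

/-- Product rule for `ξ = P/|P|`: the first integral gives `d(1/|P|) = g(P,·)/|P|`, and the Hessian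
supplies the remaining terms. -/
theorem leviCivita_xi_of_flat (hP : ∀ x, grad g u x ≠ 0) (x : M) (v : TangentSpace I x) :
    leviCivita g (xi g) x v = √(g.inner x (grad g u x) (grad g u x)) •
      (g.inner x (xi g x) v • xi g x + (2 * g.inner x (xi g x) (J x v)) • J x (xi g x) - v) := by
  let N : M → ℝ := fun y ↦ √(g.inner y (grad g u y) (grad g u y))
  have hpos := fun y ↦ g.pos y _ (hP y)
  have hNpos : 0 < N x := Real.sqrt_pos.2 (hpos x)
  have hNsq : N x ^ 2 = g.inner x (grad g u x) (grad g u x) := Real.sq_sqrt (hpos x).le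
  have hPs : SmoothAt (grad g u) x := smoothAt_grad g hu.contMDiffAt
  have hs := hPs.inner g hPs
  have hd : HasDerivAt (fun t ↦ (√t)⁻¹) (-(1 / (2 * N x)) / N x ^ 2)
      (g.inner x (grad g u x) (grad g u x)) :=
    (Real.hasDerivAt_sqrt (hpos x).ne').inv hNpos.ne'
  have hc : CMDiffAt ∞ (fun y ↦ (N y)⁻¹) x :=
    ContMDiffAt.comp (I' := 𝓘(ℝ, ℝ)) (g := fun t ↦ (√t)⁻¹) x
      ((Real.contDiffAt_sqrt (hpos x).ne').inv hNpos.ne').contMDiffAt hs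
  have hxi : xi g = (fun y ↦ (N y)⁻¹) • grad g u :=
    funext fun y ↦ xi_of_flat hJ hu hdim hflat hn (hP y)
  have hPx : grad g u x = N x • xi g x := by
    rw [xi_of_flat hJ hu hdim hflat hn (hP x), smul_smul, mul_inv_cancel₀ hNpos.ne', one_smul]
  have hdN := mvfderiv_real_comp (φ := fun t ↦ (√t)⁻¹)
    (f := fun y ↦ g.inner y (grad g u y) (grad g u y)) hd (hs.mdifferentiableAt (by simp)) v
  rw [mvfderiv_norm_grad_of_flat hJ hu hdim hflat] at hdN
  have hcov := cov_smul (leviCivita g) hc hPs v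
  rw [← hxi, hdN, hess_of_flat hJ hu.contMDiffAt hdim (hflat x), ← hNsq, hPx] at hcov
  rw [hcov]
  change _ = N x • _
  simp only [map_smul, smul_apply, smul_eq_mul]
  match_scalars <;> field_simp

/-- The operator `∇ξ` has eigenvalues `-|P|` on `D_τ`, `-3|P|` on `Jξ` and `0` on `ξ`; these are
`k/2`, `-p*` and `0`. -/
theorem isB0_of_flat (hP : ∀ x, grad g u x ≠ 0) :
    IsB0 g J (fun x ↦ -2 * √(g.inner x (grad g u x) (grad g u x)))
      (fun x ↦ 3 * √(g.inner x (grad g u x) (grad g u x))) := by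
  have hpos := fun y ↦ g.pos y _ (hP y)
  have h1 : ∀ x, g.inner x (xi g x) (xi g x) = 1 := by
    intro x
    rw [xi_of_flat hJ hu hdim hflat hn (hP x)]
    simp only [map_smul, smul_apply, smul_eq_mul, ← mul_assoc, ← mul_inv,
      Real.mul_self_sqrt (hpos x).le]
    exact inv_mul_cancel₀ (hpos x).ne'
  refine ⟨fun x ↦ ?_, fun x ↦ ?_, fun x v hv ↦ ?_, fun x ↦ ?_, fun x ↦ ?_⟩
  · rw [← grad_ne_zero_iff g, grad_scal_of_flat hJ hu hdim hflat hn]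
    have := hpos x
    exact smul_ne_zero (by positivity) (hP x)
  · have := Real.sqrt_pos.2 (hpos x)
    simpa using this.ne'
  · obtain ⟨h2, h3⟩ := Submodule.mem_inf.1 hv
    have h2 : g.inner x (xi g x) v = 0 := h2
    have h3 : g.inner x (J x (xi g x)) v = 0 := h3
    rw [hJ.inner_left, neg_eq_zero] at h3
    rw [leviCivita_xi_of_flat hJ hu hdim hflat hn hP, h2, h3]
    module
  · rw [leviCivita_xi_of_flat hJ hu hdim hflat hn hP, hJ.inner_self, hJ.sq, map_neg, h1]
    module
  · rw [leviCivita_xi_of_flat hJ hu hdim hflat hn hP, hJ.inner_self, h1]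
    module

theorem isSpecialBochnerKahler_of_flat (hP : ∀ x, grad g u x ≠ 0) :
    IsSpecialBochnerKahler n g J := by
  refine ⟨fun x ↦ bochnerTensor_of_curvatureForm hJ hn (riem_of_flat hJ hu hdim hflat x), _, _,
    -- `Φ` is quadratic in its vector, so passing from `P` to `ξ = P/|P|` multiplies the coefficient
    -- `-8` by `|P|²`; hence `b = 2a`.
    fun x ↦ -(4 * g.inner x (grad g u x) (grad g u x)),
    fun x ↦ -(8 * g.inner x (grad g u x) (grad g u x)),
    isB0_of_flat hJ hu hdim hflat hn hP, fun x X Y Z ↦ ?_, fun x ↦ ?_,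
    bochnerConst_of_flat hJ hu hdim hflat hn, fun x ↦ by ring⟩
  · have hpos := g.pos x _ (hP x)
    rw [riem_of_flat hJ hu hdim hflat, phiTensor_eq, xi_of_flat hJ hu hdim hflat hn (hP x),
      phiForm_smul, smul_smul, inv_pow, Real.sq_sqrt hpos.le, neg_mul, mul_assoc,
      mul_inv_cancel₀ hpos.ne', mul_one]
  · have := Real.sq_sqrt (g.pos x _ (hP x)).le
    linear_combination 4 * this

end Flat

section FlatConnected

variable {M : Type*} [TopologicalSpace M] [ChartedSpace E M] [IsManifold 𝓘(ℝ, E) ∞ M]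
  {g : Metric 𝓘(ℝ, E) M} {J : EndField 𝓘(ℝ, E) M}

/-- A zero of `P` makes the first integral `|P|² e^{2u}` vanish on the whole component; then `du =
0` there and `u` is constant on it. -/
theorem grad_ne_zero_of_flat (hJ : IsKahler g J) {u : M → ℝ}
    (hu : ContMDiff 𝓘(ℝ, E) 𝓘(ℝ, ℝ) ∞ u) (hdim : 2 < Module.finrank ℝ E)
    (hflat : IsFlat (complexConformalConnection g J u)) {x : M}
    (hx : ∃ y ∈ connectedComponent x, u y ≠ u x) : grad g u x ≠ 0 := by
  intro h0
  have hP : ∀ z, SmoothAt (grad g u) z := fun z ↦ smoothAt_grad g hu.contMDiffAt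
  have hs : ContMDiff 𝓘(ℝ, E) 𝓘(ℝ, ℝ) ∞ (fun y ↦ g.inner y (grad g u y) (grad g u y)) :=
    fun z ↦ (hP z).inner g (hP z)
  have he : ContMDiff 𝓘(ℝ, E) 𝓘(ℝ, ℝ) ∞ (fun y ↦ Real.exp (2 * u y)) :=
    (Real.contDiff_exp.comp (contDiff_const.mul contDiff_id)).contMDiff.comp hu
  have hc : ∀ y ∈ connectedComponent x,
      g.inner y (grad g u y) (grad g u y) * Real.exp (2 * u y) = 0 := by
    intro y hy
    have := eq_of_mvfderiv_eq_zero (f := fun y ↦ g.inner y (grad g u y) (grad g u y) *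
      Real.exp (2 * u y)) (hs.mul he) (fun z _ ↦ ContinuousLinearMap.ext fun v ↦ ?_) hy
    · rw [this, h0, map_zero, zero_mul]
    · have hd : HasDerivAt (fun t : ℝ ↦ Real.exp (2 * t)) (Real.exp (2 * u z) * 2) (u z) := by
        simpa using ((hasDerivAt_id (u z)).const_mul 2).exp
      rw [mvfderiv_fun_mul (hs.mdifferentiableAt (by simp)) (he.mdifferentiableAt (by simp))]
      simp only [add_apply, smul_apply, smul_eq_mul, zero_apply]
      rw [mvfderiv_norm_grad_of_flat hJ hu hdim hflat,
        mvfderiv_real_comp hd (hu.mdifferentiableAt (by simp)), ← inner_grad g u z v]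
      ring
  obtain ⟨y, hy, hne⟩ := hx
  refine hne (eq_of_mvfderiv_eq_zero hu (fun z hz ↦ ?_) hy)
  by_contra h
  exact (mul_pos (g.pos z _ ((grad_ne_zero_iff g).2 h)) (Real.exp_pos _)).ne' (hc z hz)

end FlatConnected

end

/-! ### Curvature in the direction `ξ` for a `B_0`-distribution -/

section

variable [FiniteDimensional ℝ E]

section Xi

variable {g : Metric I M} {x : M} (hτ : mvfderiv I (scal g) x ≠ 0)
include hτ

theorem inner_xi_self : g.inner x (xi g x) (xi g x) = 1 := by
  have h := g.pos x _ ((grad_ne_zero_iff g).2 hτ)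
  simp only [xi, map_smul, smul_apply, smul_eq_mul, ← mul_assoc, ← mul_inv,
    Real.mul_self_sqrt h.le]
  exact inv_mul_cancel₀ h.ne'

theorem smoothAt_xi : SmoothAt (xi g) x := by
  have hG : SmoothAt (grad g (scal g)) x := smoothAt_grad g (contMDiffAt_scal g)
  have h := g.pos x _ ((grad_ne_zero_iff g).2 hτ)
  exact hG.smul (ContMDiffAt.comp (I' := 𝓘(ℝ, ℝ)) (g := fun t ↦ (√t)⁻¹) x
    ((Real.contDiffAt_sqrt h.ne').inv (Real.sqrt_pos.2 h).ne').contMDiffAt (hG.inner g hG))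

theorem mvfderiv_scal_eq_zero {v : TangentSpace I x} (hv : g.inner x (xi g x) v = 0) :
    mvfderiv I (scal g) x v = 0 := by
  have h := g.pos x _ ((grad_ne_zero_iff g).2 hτ)
  rw [xi, map_smul, smul_apply, smul_eq_mul, inner_grad g _ x v] at hv
  exact (mul_eq_zero.1 hv).resolve_left (inv_ne_zero (Real.sqrt_pos.2 h).ne')

end Xi

section BZero

variable {g : Metric I M} {J : EndField I M} (hJ : IsKahler g J) {k p : M → ℝ}
  (hB : IsB0 g J k p)
include hJ hB

theorem leviCivita_xi_of_isB0 (x : M) (v : TangentSpace I x) : leviCivita g (xi g) x v =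
    (k x / 2) • (v - g.inner x (xi g x) v • xi g x - g.inner x (J x (xi g x)) v • J x (xi g x))
      - (p x * g.inner x (J x (xi g x)) v) • J x (xi g x) := by
  have h1 := inner_xi_self (hB.dscal_ne x)
  set w := v - g.inner x (xi g x) v • xi g x - g.inner x (J x (xi g x)) v • J x (xi g x) with hw
  have hmem : w ∈ scalarDist g J x := by
    refine Submodule.mem_inf.2 ⟨?_, ?_⟩
    · change g.inner x (xi g x) w = 0
      simp [hw, h1, hJ.inner_self]
    · change g.inner x (J x (xi g x)) w = 0
      simp [hw, h1, hJ.hermitian, g.symm x (J x (xi g x)) (xi g x), hJ.inner_self]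
  have hv : v = w + g.inner x (xi g x) v • xi g x + g.inner x (J x (xi g x)) v • J x (xi g x) := by
    rw [hw]; abel
  conv_lhs => rw [hv]
  rw [map_add, map_add, map_smul, map_smul, hB.nabla_dist x w hmem, hB.nabla_xi, hB.nabla_Jxi]
  module

omit hB in
theorem leviCivita_J_xi {x : M} (hτ : mvfderiv I (scal g) x ≠ 0) (v : TangentSpace I x) :
    leviCivita g (fun y ↦ J y (xi g y)) x v = J x (leviCivita g (xi g) x v) :=
  hJ.parallel _ x v (smoothAt_xi hτ).mdiffAt

/-- A vector orthogonal to `Jξ` extends to a smooth vector field that is orthogonal to `Jξ` and has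
constant inner product with `ξ`. -/
theorem exists_smooth_extension {x : M} {u : TangentSpace I x}
    (hu : g.inner x (J x (xi g x)) u = 0) : ∃ X : Π y : M, TangentSpace I y, SmoothAt X x ∧
      X x = u ∧ (∀ y, g.inner y (J y (xi g y)) (X y) = 0) ∧
      ∀ y, g.inner y (xi g y) (X y) = g.inner x (xi g x) u := by
  have hξ := smoothAt_xi (hB.dscal_ne x)
  have hU := smoothAt_extend (I := I) u
  refine ⟨extend E u - (fun y ↦ g.inner y (xi g y) (extend E u y) - g.inner x (xi g x) u) • xi g
    - (fun y ↦ g.inner y (J y (xi g y)) (extend E u y)) • fun y ↦ J y (xi g y),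
    (hU.sub (hξ.smul ((hξ.inner g hU).sub contMDiffAt_const))).sub
      ((hJ.smoothAt hξ).smul ((hJ.smoothAt hξ).inner g hU)), ?_, fun y ↦ ?_, fun y ↦ ?_⟩
  · simp [hu]
  · have h1 := inner_xi_self (hB.dscal_ne y)
    simp [h1, hJ.hermitian, g.symm y (J y (xi g y)) (xi g y), hJ.inner_self]
  · have h1 := inner_xi_self (hB.dscal_ne y)
    simp [h1, hJ.inner_self]

/-- `IsB0` assumes no regularity of `k`. It is recovered as the smooth quotient `2 g(∇_X ξ,
X)/g(X,X)`, with `X` a nonvanishing local section of `D_τ`. -/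
theorem contMDiffAt_of_isB0 (hdim : 2 < Module.finrank ℝ E) (x : M) : CMDiffAt ∞ k x := by
  obtain ⟨v, hv, hvs⟩ := exists_orthogonal g hdim ![xi g x, J x (xi g x)]
  have h0 : g.inner x (xi g x) v = 0 := hvs 0
  have h1 : g.inner x (J x (xi g x)) v = 0 := hvs 1
  obtain ⟨X, hX, rfl, hX1, hX0⟩ := exists_smooth_extension hJ hB h1
  have hξ := smoothAt_xi (hB.dscal_ne x)
  have hpos := g.pos x _ hv
  refine ContMDiffAt.congr_of_eventuallyEq
    (f := fun y ↦ 2 * (g.inner y (leviCivita g (xi g) y (X y)) (X y) / g.inner y (X y) (X y)))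
    (contMDiffAt_const.mul (((hX.leviCivita g hξ).inner g hX).div₀ (hX.inner g hX) hpos.ne')) ?_
  filter_upwards [(hX.inner g hX).continuousAt.eventually_ne hpos.ne'] with y hy
  rw [leviCivita_xi_of_isB0 hJ hB, hX1, hX0, h0]
  simp only [mul_zero, zero_smul, sub_zero, map_smul, smul_apply, smul_eq_mul]
  field_simp

/-- On the adapted extensions `∇_Z ξ = (k/2)(Z - c ξ)` with `c` constant, so one more derivative is
available. Fields orthogonal to `Jξ` keep `p` out of this formula, so `p` is never differentiated
and enters only through the `Jξ` component of the bracket. -/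
theorem riem_xi_of_isB0 (hdim : 2 < Module.finrank ℝ E) {x : M} {u v : TangentSpace I x}
    (hu : g.inner x (J x (xi g x)) u = 0) (hv : g.inner x (J x (xi g x)) v = 0) :
    riem g x u v (xi g x) =
      (mvfderiv I k x u / 2) • (v - g.inner x (xi g x) v • xi g x)
      - (mvfderiv I k x v / 2) • (u - g.inner x (xi g x) u • xi g x)
      - (k x ^ 2 / 4) • (g.inner x (xi g x) v • u - g.inner x (xi g x) u • v)
      - (k x * (k x / 2 + p x) * g.inner x (J x u) v) • J x (xi g x) := by
  obtain ⟨X, hX, rfl, hX1, hX0⟩ := exists_smooth_extension hJ hB hu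
  obtain ⟨Y, hY, rfl, hY1, hY0⟩ := exists_smooth_extension hJ hB hv
  have hξ := smoothAt_xi (hB.dscal_ne x)
  have hJξ := hJ.smoothAt hξ
  have hk := contMDiffAt_of_isB0 hJ hB hdim x
  have hr : CMDiffAt ∞ (fun y ↦ k y / 2) x := hk.div_const 2
  have hdr : ∀ w, mvfderiv I (fun y ↦ k y / 2) x w = mvfderiv I k x w / 2 := fun w ↦ by
    rw [mvfderiv_real_comp (φ := fun t ↦ t / 2) ((hasDerivAt_id _).div_const 2)
      (hk.mdifferentiableAt (by simp))]
    ring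
  have hcov : ∀ {Z : Π y : M, TangentSpace I y} (hZ : SmoothAt Z x)
      (hZ1 : ∀ y, g.inner y (J y (xi g y)) (Z y) = 0)
      (hZ0 : ∀ y, g.inner y (xi g y) (Z y) = g.inner x (xi g x) (Z x)) (w : TangentSpace I x),
      leviCivita g (fun y ↦ leviCivita g (xi g) y (Z y)) x w = (k x / 2) • (leviCivita g Z x w
        - g.inner x (xi g x) (Z x) • leviCivita g (xi g) x w)
        + (mvfderiv I k x w / 2) • (Z x - g.inner x (xi g x) (Z x) • xi g x) := by
    intro Z hZ hZ1 hZ0 w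
    have h : (fun y ↦ leviCivita g (xi g) y (Z y)) =
        (fun y ↦ k y / 2) • (Z - (fun _ : M ↦ g.inner x (xi g x) (Z x)) • xi g) := by
      funext y
      rw [leviCivita_xi_of_isB0 hJ hB, hZ1, hZ0]
      simp
    have hc : SmoothAt ((fun _ : M ↦ g.inner x (xi g x) (Z x)) • xi g) x := hξ.smul contMDiffAt_const
    rw [h, cov_smul _ hr (hZ.sub hc), cov_sub _ hZ hc, cov_smul _ contMDiffAt_const hξ, hdr,
      mvfderiv_const]
    simp
  have hη : ∀ {Z : Π y : M, TangentSpace I y} (hZ : SmoothAt Z x)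
      (hZ0 : ∀ y, g.inner y (xi g y) (Z y) = g.inner x (xi g x) (Z x)) (w : TangentSpace I x),
      g.inner x (xi g x) (leviCivita g Z x w) = -g.inner x (leviCivita g (xi g) x w) (Z x) := by
    intro Z hZ hZ0 w
    have h := leviCivita_metric g w hξ.mdiffAt hZ.mdiffAt
    rw [funext hZ0, mvfderiv_const, zero_apply] at h
    linarith
  have hq : ∀ {Z : Π y : M, TangentSpace I y} (hZ : SmoothAt Z x)
      (hZ1 : ∀ y, g.inner y (J y (xi g y)) (Z y) = 0) (w : TangentSpace I x),
      g.inner x (J x (xi g x)) (leviCivita g Z x w) =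
        -g.inner x (J x (leviCivita g (xi g) x w)) (Z x) := by
    intro Z hZ hZ1 w
    have h := leviCivita_metric g w hJξ.mdiffAt hZ.mdiffAt
    rw [funext hZ1, mvfderiv_const, zero_apply, leviCivita_J_xi hJ (hB.dscal_ne x)] at h
    linarith
  have h0 : g.inner x (xi g x) (mlieBracket I X Y x) = 0 := by
    rw [mlieBracket_eq g hX hY, map_sub, hη hY hY0, hη hX hX0, leviCivita_xi_of_isB0 hJ hB,
      leviCivita_xi_of_isB0 hJ hB, hu, hv]
    simp [g.symm x (Y x) (X x)]
    ring
  -- The bracket leaves the orthogonal complement of `Jξ`; this is the source of the `Jξ` term in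
  -- the result.
  have h1 : g.inner x (J x (xi g x)) (mlieBracket I X Y x) =
      -(k x * g.inner x (J x (X x)) (Y x)) := by
    rw [mlieBracket_eq g hX hY, map_sub, hq hY hY1, hq hX hX1, leviCivita_xi_of_isB0 hJ hB,
      leviCivita_xi_of_isB0 hJ hB, hu, hv]
    simp [hv, hu, hJ.inner_left, hJ.inner_comm (Y x) (X x)]
    ring
  rw [riem_eq g hX hY hξ, curvatureField, hcov hX hX1 hX0, hcov hY hY1 hY0,
    leviCivita_xi_of_isB0 hJ hB x (mlieBracket I X Y x), h0, h1, mlieBracket_eq g hX hY,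
    leviCivita_xi_of_isB0 hJ hB, leviCivita_xi_of_isB0 hJ hB, hu, hv]
  module

end BZero

end

/-! ### Existence and uniqueness of the curvature functions -/

section

variable [FiniteDimensional ℝ E]

section BochnerQ

variable (n : ℕ) (g : Metric I M) {x : M}

theorem bochnerQ_symm (v w : TangentSpace I x) : bochnerQ n g x v w = bochnerQ n g x w v := by
  rw [bochnerQ, bochnerQ, ricci_symm, g.symm]

theorem bochnerQ_add_left (v v' w : TangentSpace I x) :
    bochnerQ n g x (v + v') w = bochnerQ n g x v w + bochnerQ n g x v' w := by
  simp only [bochnerQ, ricci_add_left, map_add, add_apply]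
  ring

theorem bochnerQ_smul_left (c : ℝ) (v w : TangentSpace I x) :
    bochnerQ n g x (c • v) w = c * bochnerQ n g x v w := by
  simp only [bochnerQ, ricci_smul_left, map_smul, smul_apply, smul_eq_mul]
  ring

theorem bochnerQ_add_right (v w w' : TangentSpace I x) :
    bochnerQ n g x v (w + w') = bochnerQ n g x v w + bochnerQ n g x v w' := by
  rw [bochnerQ_symm, bochnerQ_add_left, bochnerQ_symm n g w, bochnerQ_symm n g w']

theorem bochnerQ_smul_right (c : ℝ) (v w : TangentSpace I x) :
    bochnerQ n g x v (c • w) = c * bochnerQ n g x v w := by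
  rw [bochnerQ_symm, bochnerQ_smul_left, bochnerQ_symm]

theorem bochnerQ_neg_left (v w : TangentSpace I x) :
    bochnerQ n g x (-v) w = -bochnerQ n g x v w := by
  rw [← neg_one_smul ℝ v, bochnerQ_smul_left, neg_one_mul]

theorem inner_bochnerQOp (v w : TangentSpace I x) :
    g.inner x (bochnerQOp n g x v) w = bochnerQ n g x v w := by
  let L : TangentSpace I x →ₗ[ℝ] ℝ :=
    { toFun := bochnerQ n g x v
      map_add' := bochnerQ_add_right n g v
      map_smul' := fun c w ↦ bochnerQ_smul_right n g c v w }
  have h : bochnerQ n g x v w = L w := rfl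
  rw [h, ← sum_inner_frame_left g x w]
  simp only [bochnerQOp, map_sum, map_smul, sum_apply, smul_apply, smul_eq_mul, inner_frame]
  simp [L, mul_comm]

variable {n g} {J : EndField I M} (hJ : IsKahler g J)
include hJ

theorem bochnerQ_J (v w : TangentSpace I x) :
    bochnerQ n g x (J x v) (J x w) = bochnerQ n g x v w := by
  rw [bochnerQ, bochnerQ, hJ.ricci_J, hJ.hermitian]

/-- On a Bochner-Kähler manifold the curvature operators `R(v, Jv)` are determined by `Q`. -/
theorem riem_J_of_isBochnerKahler (h : IsBochnerKahler n g J) {ξ v : TangentSpace I x}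
    (h0 : g.inner x ξ v = 0) (h1 : g.inner x (J x ξ) v = 0) :
    riem g x v (J x v) ξ = (2 * bochnerQ n g x (J x v) ξ) • v - (2 * bochnerQ n g x v ξ) • J x v
      - (2 * bochnerQ n g x v v) • J x ξ
      - (2 * g.inner x v v) • J x (bochnerQOp n g x ξ) := by
  have hb := h x v (J x v) ξ
  have h2 : g.inner x (J x v) ξ = 0 := by
    rw [hJ.inner_left, g.symm, h1, neg_zero]
  rw [bochnerTensor, hJ.sq, bochnerQ_J hJ, bochnerQ_neg_left, h2, g.symm x v ξ, h0, hJ.hermitian,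
    map_neg, neg_apply, g.symm x v ξ, h0] at hb
  rw [← sub_eq_zero, ← hb]
  module

end BochnerQ

section BZero

variable {g : Metric I M} {J : EndField I M} (hJ : IsKahler g J) {k p : M → ℝ}
  (hB : IsB0 g J k p) {n : ℕ} (hn : Module.finrank ℝ E = 2 * n) (hn3 : 3 ≤ n)
  (hBK : IsBochnerKahler n g J) {x : M} {v w : TangentSpace I x}
include hJ hB hn hn3 hBK

/-- Both sides are `R(v,Jv)ξ` for `v` in `D_τ`, once from the Bochner identity and once from the
derivatives of `ξ`. Its components determine `Q`. -/
theorem bochnerQ_formula (h0 : g.inner x (xi g x) v = 0) (h1 : g.inner x (J x (xi g x)) v = 0) :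
    (2 * bochnerQ n g x (J x v) (xi g x)) • v - (2 * bochnerQ n g x v (xi g x)) • J x v
      - (2 * bochnerQ n g x v v) • J x (xi g x)
      - (2 * g.inner x v v) • J x (bochnerQOp n g x (xi g x)) =
    (mvfderiv I k x v / 2) • J x v - (mvfderiv I k x (J x v) / 2) • v
      - (k x * (k x / 2 + p x) * g.inner x v v) • J x (xi g x) := by
  have h2 : g.inner x (J x (xi g x)) (J x v) = 0 := by rw [hJ.hermitian, h0]
  have h3 : g.inner x (xi g x) (J x v) = 0 := by
    rw [hJ.inner_left, neg_eq_zero] at h1; exact h1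
  rw [← riem_J_of_isBochnerKahler hJ hBK h0 h1, riem_xi_of_isB0 hJ hB (by omega) h1 h2, h0, h3,
    hJ.hermitian]
  module

/-- Pair `bochnerQ_formula` with `Jw`, for `v` orthogonal to `ξ, Jξ, w, Jw`: only `Q(ξ,w)|v|²`
survives. Avoiding four vectors needs dimension greater than four, which is where `n ≥ 3` matters.
-/
theorem bochnerQ_xi_of_orthogonal (h0 : g.inner x (xi g x) w = 0) :
    bochnerQ n g x (xi g x) w = 0 := by
  obtain ⟨v, hv, hvs⟩ := exists_orthogonal (m := 4) g (by omega)
    ![xi g x, J x (xi g x), w, J x w]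
  have a0 : g.inner x (xi g x) v = 0 := hvs 0
  have a1 : g.inner x (J x (xi g x)) v = 0 := hvs 1
  have a2 : g.inner x w v = 0 := hvs 2
  have a3 : g.inner x (J x w) v = 0 := hvs 3
  have h := congrArg (fun z ↦ g.inner x z (J x w)) (bochnerQ_formula hJ hB hn hn3 hBK a0 a1)
  simp only [map_sub, map_smul, sub_apply, smul_apply, smul_eq_mul, hJ.hermitian,
    inner_bochnerQOp, g.symm x v, a2, a3, h0] at h
  have := g.pos x v hv
  simpa [this.ne'] using h

theorem bochnerQ_dist_self (h0 : g.inner x (xi g x) v = 0) (h1 : g.inner x (J x (xi g x)) v = 0) :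
    bochnerQ n g x v v =
      (k x * (k x / 2 + p x) / 2 - bochnerQ n g x (xi g x) (xi g x)) * g.inner x v v := by
  have h2 : g.inner x v (xi g x) = 0 := by rw [g.symm, h0]
  have h3 : g.inner x v (J x (xi g x)) = 0 := by rw [g.symm, h1]
  have h := congrArg (fun z ↦ g.inner x z (J x (xi g x))) (bochnerQ_formula hJ hB hn hn3 hBK h0 h1)
  simp only [map_sub, map_smul, sub_apply, smul_apply, smul_eq_mul, hJ.hermitian,
    inner_bochnerQOp, h2, h3, inner_xi_self (hB.dscal_ne x)] at h
  linarith

/-- Polarization makes `Q = c g` on `D_τ`. The mixed terms with `ξ` vanish, and `J`-invariance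
carries both facts about `ξ` over to `Jξ`. -/
theorem exists_bochnerQ_eq (x : M) : ∃ a b : ℝ, ∀ v w : TangentSpace I x,
    bochnerQ n g x v w = a / 8 * g.inner x v w + b / 8 * (g.inner x (xi g x) v *
      g.inner x (xi g x) w + g.inner x (xi g x) (J x v) * g.inner x (xi g x) (J x w)) := by
  set c := k x * (k x / 2 + p x) / 2 - bochnerQ n g x (xi g x) (xi g x) with hc
  set ξ := xi g x with hξ
  have hξ1 : g.inner x ξ ξ = 1 := inner_xi_self (hB.dscal_ne x)
  have hdist : ∀ v w : TangentSpace I x, g.inner x ξ v = 0 → g.inner x (J x ξ) v = 0 →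
      g.inner x ξ w = 0 → g.inner x (J x ξ) w = 0 → bochnerQ n g x v w = c * g.inner x v w := by
    intro v w v0 v1 w0 w1
    have h1 : _ = c * _ := bochnerQ_dist_self hJ hB hn hn3 hBK v0 v1
    have h2 : _ = c * _ := bochnerQ_dist_self hJ hB hn hn3 hBK w0 w1
    have h3 : _ = c * _ := bochnerQ_dist_self hJ hB hn hn3 hBK (v := v + w)
      (by rw [map_add, v0, w0, add_zero]) (by rw [map_add, v1, w1, add_zero])
    simp only [bochnerQ_add_left, bochnerQ_add_right, map_add, add_apply, g.symm x w v,
      bochnerQ_symm n g w v] at h3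
    linarith
  have hdec : ∀ v : TangentSpace I x, ∃ v' : TangentSpace I x, g.inner x ξ v' = 0 ∧
      g.inner x (J x ξ) v' = 0 ∧ v = v' + g.inner x ξ v • ξ + g.inner x (J x ξ) v • J x ξ :=
    fun v ↦ ⟨v - g.inner x ξ v • ξ - g.inner x (J x ξ) v • J x ξ,
      by simp [hξ1, hJ.inner_self],
      by simp [hξ1, hJ.hermitian, g.symm x (J x ξ) ξ, hJ.inner_self], by abel⟩
  have hJdist : ∀ v : TangentSpace I x, g.inner x (J x ξ) v = 0 →
      bochnerQ n g x (J x ξ) v = 0 := by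
    intro v v1
    rw [← bochnerQ_J hJ, hJ.sq, bochnerQ_neg_left, neg_eq_zero]
    refine bochnerQ_xi_of_orthogonal hJ hB hn hn3 hBK ?_
    rw [hJ.inner_left, neg_eq_zero] at v1; exact v1
  have hξJ : bochnerQ n g x ξ (J x ξ) = 0 :=
    bochnerQ_xi_of_orthogonal hJ hB hn hn3 hBK (hJ.inner_self _)
  -- Forced by `Q = a/8` on unit vectors of `D_τ` and `Q(ξ,ξ) = a/8 + b/8`.
  refine ⟨8 * c, 8 * (bochnerQ n g x ξ ξ - c), fun v w ↦ ?_⟩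
  obtain ⟨v', v0, v1, hv⟩ := hdec v
  obtain ⟨w', w0, w1, hw⟩ := hdec w
  have hs : ∀ e, g.inner x ξ (J x e) = -g.inner x (J x ξ) e := fun e ↦ by
    rw [hJ.inner_left, neg_neg]
  rw [hs, hs]
  -- The coefficients contain `v` and `w`; they become free scalars so that the decompositions can
  -- be substituted.
  generalize g.inner x ξ v = s at hv ⊢
  generalize g.inner x (J x ξ) v = t at hv ⊢
  generalize g.inner x ξ w = s' at hw ⊢
  generalize g.inner x (J x ξ) w = t' at hw ⊢
  subst hv hw
  have a1 := bochnerQ_xi_of_orthogonal hJ hB hn hn3 hBK v0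
  have a2 := bochnerQ_xi_of_orthogonal hJ hB hn hn3 hBK w0
  rw [← hξ] at a1 a2
  simp only [bochnerQ_add_left, bochnerQ_add_right, bochnerQ_smul_left, bochnerQ_smul_right,
    hdist v' w' v0 v1 w0 w1, bochnerQ_J hJ, bochnerQ_symm n g v', bochnerQ_symm n g (J x ξ) ξ, a1, a2,
    hJdist v' v1, hJdist w' w1, hξJ, map_add, map_smul, add_apply, smul_apply, smul_eq_mul,
    hJ.hermitian, hξ1, g.symm x v' ξ, g.symm x v' (J x ξ), g.symm x (J x ξ) ξ, hJ.inner_self,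
    v0, v1, w0, w1]
  ring

theorem exists_isCurvatureFunctions : ∃ a b : M → ℝ, IsCurvatureFunctions g J a b := by
  choose a b h using exists_bochnerQ_eq hJ hB hn hn3 hBK
  refine ⟨a, b, fun x u v w ↦ ?_⟩
  have h1 := bochnerTensor_of_bochnerQ hJ (h x) u v w
  rw [hBK, eq_comm, sub_eq_zero] at h1
  exact h1

end BZero

section Uniqueness

variable {g : Metric I M} {J : EndField I M} (hJ : IsKahler g J)
include hJ

theorem piTensor_J {x : M} (v : TangentSpace I x) :
    piTensor g J x v (J x v) (J x v) = g.inner x v v • v := by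
  simp only [piTensor, hJ.sq, hJ.hermitian, hJ.inner_self, map_neg, neg_apply]
  module

theorem phiForm_J {x : M} {ξ v : TangentSpace I x} (h0 : g.inner x ξ v = 0)
    (h1 : g.inner x ξ (J x v) = 0) : phiForm g J x ξ v (J x v) (J x v) = 0 := by
  simp [phiForm, hJ.sq, h0, h1]

theorem phiForm_xi_J {x : M} {ξ : TangentSpace I x} (h : g.inner x ξ ξ = 1) :
    phiForm g J x ξ ξ (J x ξ) (J x ξ) = ξ := by
  simp only [phiForm, hJ.sq, hJ.hermitian, hJ.inner_self, map_neg, neg_apply, h]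
  module

/-- Evaluation on `(v, Jv, Jv)` with `v` in `D_τ` kills `Φ` and isolates `a`; evaluation on `(ξ, Jξ,
Jξ)` then isolates `b`, since `Φ` gives `ξ`. -/
theorem IsCurvatureFunctions.unique (hdim : 2 < Module.finrank ℝ E)
    (hτ : ∀ x : M, mvfderiv I (scal g) x ≠ 0) {a b a' b' : M → ℝ}
    (h : IsCurvatureFunctions g J a b) (h' : IsCurvatureFunctions g J a' b') :
    a = a' ∧ b = b' := by
  have ha : a = a' := by
    funext x
    obtain ⟨v, hv, hvs⟩ := exists_orthogonal g hdim ![xi g x, J x (xi g x)]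
    have h0 : g.inner x (xi g x) v = 0 := hvs 0
    have h1 : g.inner x (J x (xi g x)) v = 0 := hvs 1
    rw [hJ.inner_left, neg_eq_zero] at h1
    have e := (h x v (J x v) (J x v)).symm.trans (h' x v (J x v) (J x v))
    rw [phiTensor_eq, phiForm_J hJ h0 h1, piTensor_J hJ, smul_zero, smul_zero, add_zero,
      add_zero] at e
    exact smul_left_injective ℝ (smul_ne_zero (g.pos x v hv).ne' hv) e
  refine ⟨ha, funext fun x ↦ ?_⟩
  have h1 := inner_xi_self (hτ x)
  have e := (h x (xi g x) (J x (xi g x)) (J x (xi g x))).symm.trans (h' x _ _ _)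
  rw [phiTensor_eq, phiForm_xi_J hJ h1, ha, add_right_inj] at e
  refine smul_left_injective ℝ (fun h0 ↦ ?_) e
  rw [h0, map_zero] at h1
  exact zero_ne_one h1

end Uniqueness

end

/-! ### From the special conditions to a flat connection -/

section

variable [FiniteDimensional ℝ E]

section Algebra

variable {g : Metric I M} {J : EndField I M} (hJ : IsKahler g J) {x : M}
  {ξ v : TangentSpace I x}
include hJ

theorem piTensor_J_of_orthogonal (h0 : g.inner x ξ v = 0) (h1 : g.inner x ξ (J x v) = 0) :
    piTensor g J x v (J x v) ξ = -(g.inner x v v / 2) • J x ξ := by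
  simp only [piTensor, hJ.sq, hJ.hermitian, map_neg, neg_apply, g.symm x _ ξ, h0, h1]
  module

theorem phiForm_J_of_orthogonal (hξ : g.inner x ξ ξ = 1) (h0 : g.inner x ξ v = 0)
    (h1 : g.inner x ξ (J x v) = 0) :
    phiForm g J x ξ v (J x v) ξ = -(g.inner x v v / 4) • J x ξ := by
  simp only [phiForm, hJ.sq, hJ.hermitian, map_neg, neg_apply, g.symm x v ξ, g.symm x (J x v) ξ,
    h0, h1, hξ, hJ.inner_self]
  module

theorem piTensor_of_orthogonal (hξ : g.inner x ξ ξ = 1) (h0 : g.inner x ξ v = 0)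
    (h1 : g.inner x ξ (J x v) = 0) : piTensor g J x ξ v ξ = -(1 / 4 : ℝ) • v := by
  simp only [piTensor, g.symm x v ξ, g.symm x (J x v) ξ, hJ.inner_left ξ, hJ.inner_self, h0, h1, hξ]
  module

theorem phiForm_of_orthogonal (hξ : g.inner x ξ ξ = 1) (h0 : g.inner x ξ v = 0)
    (h1 : g.inner x ξ (J x v) = 0) : phiForm g J x ξ ξ v ξ = -(1 / 8 : ℝ) • v := by
  simp only [phiForm, g.symm x v ξ, g.symm x (J x v) ξ, hJ.inner_left ξ, hJ.inner_self, h0, h1, hξ]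
  module

end Algebra

section Converse

variable {g : Metric I M} {J : EndField I M} (hJ : IsKahler g J) {k p a b : M → ℝ}
  (hB : IsB0 g J k p) {n : ℕ} (hn : Module.finrank ℝ E = 2 * n) (hn3 : 3 ≤ n)
  (hR : IsCurvatureFunctions g J a b) (ha : ∀ x, a x + k x ^ 2 = 0)
  (hb : ∀ x, (2 * a x - b x) / 2 = 0)
include hJ hB hn hR ha hb

theorem scal_eq_of_isB0 : scal g = fun x ↦ -((n + 1) * (n + 2)) * k x ^ 2 := by
  funext x
  rw [scal_of_curvatureForm hJ hn (hR x), inner_xi_self (hB.dscal_ne x)]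
  linear_combination (n + 1) * (n + 2) * ha x - 2 * (n + 1) * hb x

theorem scal_neg_of_isB0 (x : M) : scal g x < 0 := by
  rw [scal_eq_of_isB0 hJ hB hn hR ha hb]
  have := pow_pos (abs_pos.2 (hB.k_ne x)) 2
  rw [sq_abs] at this
  have : 0 < ((n : ℝ) + 1) * (n + 2) * k x ^ 2 := by positivity
  linarith

theorem contMDiff_log_scal : ContMDiff I 𝓘(ℝ, ℝ) ∞ (fun x ↦ -Real.log (-scal g x) / 2) := by
  intro x
  have h := scal_neg_of_isB0 hJ hB hn hR ha hb x
  have : ContDiffAt ℝ ∞ (fun t ↦ -Real.log (-t) / 2) (scal g x) :=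
    ((contDiffAt_id.neg.log (by simpa using h.ne)).neg).div_const 2
  exact ContMDiffAt.comp (I' := 𝓘(ℝ, ℝ)) (g := fun t ↦ -Real.log (-t) / 2) x this.contMDiffAt
    (contMDiffAt_scal g)

include hn3

/-- The `Jξ` component of `R(v,Jv)ξ`, for `v` in `D_τ`, is `k²|v|²` by the curvature form and
`-k(k/2 + p)|v|²` by `riem_xi_of_isB0`; then divide by `k`. -/
theorem p_eq_of_isB0 (x : M) : p x = -(3 / 2) * k x := by
  obtain ⟨v, hv, hvs⟩ := exists_orthogonal (m := 2) g (by omega) ![xi g x, J x (xi g x)]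
  have h0 : g.inner x (xi g x) v = 0 := hvs 0
  have h1 : g.inner x (J x (xi g x)) v = 0 := hvs 1
  have h1' : g.inner x (xi g x) (J x v) = 0 := by
    rw [hJ.inner_left, neg_eq_zero] at h1; exact h1
  have hξ := inner_xi_self (hB.dscal_ne x)
  have h2 : g.inner x (J x (xi g x)) (J x v) = 0 := by rw [hJ.hermitian, h0]
  have h := riem_xi_of_isB0 hJ hB (by omega) h1 h2
  rw [hR, phiTensor_eq, piTensor_J_of_orthogonal hJ h0 h1', phiForm_J_of_orthogonal hJ hξ h0 h1',
    h0, h1'] at h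
  have e := congrArg (fun z ↦ g.inner x z (J x (xi g x))) h
  simp only [map_add, map_sub, map_smul, add_apply, sub_apply, smul_apply, smul_eq_mul,
    hJ.hermitian, hξ, g.symm x v, h1, h0, zero_smul, sub_zero, mul_zero, map_zero, zero_apply] at e
  have hpos := g.pos x v hv
  have e2 : g.inner x v v * k x * (k x + (k x / 2 + p x)) = 0 := by
    linear_combination e + g.inner x v v * ha x - g.inner x v v / 2 * hb x
  have := (mul_eq_zero.1 e2).resolve_left (mul_ne_zero hpos.ne' (hB.k_ne x))
  linarith

/-- Here `R(ξ,v)ξ` is `(k²/2) v` by the curvature form and `(dk(ξ)/2 + k²/4) v` by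
`riem_xi_of_isB0`. -/
theorem mvfderiv_k_xi (x : M) : mvfderiv I k x (xi g x) = k x ^ 2 / 2 := by
  obtain ⟨v, hv, hvs⟩ := exists_orthogonal (m := 2) g (by omega) ![xi g x, J x (xi g x)]
  have h0 : g.inner x (xi g x) v = 0 := hvs 0
  have h1 : g.inner x (J x (xi g x)) v = 0 := hvs 1
  have h1' : g.inner x (xi g x) (J x v) = 0 := by
    rw [hJ.inner_left, neg_eq_zero] at h1; exact h1
  have hξ := inner_xi_self (hB.dscal_ne x)
  have h := riem_xi_of_isB0 hJ hB (by omega) (u := xi g x)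
    (by rw [g.symm, hJ.inner_self]) h1
  rw [hR, phiTensor_eq, piTensor_of_orthogonal hJ hξ h0 h1', phiForm_of_orthogonal hJ hξ h0 h1',
    h0, h1, hξ] at h
  have e := congrArg (fun z ↦ g.inner x z v) h
  simp only [map_add, map_sub, map_smul, add_apply, sub_apply, smul_apply, smul_eq_mul,
    mul_zero, zero_smul, one_smul, sub_zero, sub_self, smul_zero, zero_sub, map_neg, neg_apply] at e
  have hpos := g.pos x v hv
  refine mul_right_cancel₀ hpos.ne' ?_
  linear_combination -2 * e - g.inner x v v * ha x + g.inner x v v / 2 * hb x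

/-- Orthogonally to `ξ`, `dτ` vanishes by the choice of `ξ`; as `τ` is a nonzero constant times `k²`
and `k ≠ 0`, so does `dk`. -/
theorem mvfderiv_k (x : M) (v : TangentSpace I x) :
    mvfderiv I k x v = k x ^ 2 / 2 * g.inner x (xi g x) v := by
  have hξ := inner_xi_self (hB.dscal_ne x)
  have hk : CMDiffAt ∞ k x := contMDiffAt_of_isB0 hJ hB (by omega) x
  set w := v - g.inner x (xi g x) v • xi g x with hw
  have hw0 : g.inner x (xi g x) w = 0 := by simp [hw, hξ]
  have h := mvfderiv_scal_eq_zero (hB.dscal_ne x) hw0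
  rw [scal_eq_of_isB0 hJ hB hn hR ha hb,
    mvfderiv_real_comp (φ := fun t ↦ -((n + 1) * (n + 2)) * t ^ 2)
      ((hasDerivAt_pow 2 _).const_mul _) (hk.mdifferentiableAt (by simp))] at h
  have h2 : mvfderiv I k x w = 0 := by
    refine (mul_eq_zero.1 h).resolve_left ?_
    have := hB.k_ne x
    have h3 : (n : ℝ) + 1 ≠ 0 := by positivity
    have h4 : (n : ℝ) + 2 ≠ 0 := by positivity
    simp [this, h3, h4]
  rw [hw, map_sub, map_smul, mvfderiv_k_xi hJ hB hn hn3 hR ha hb, sub_eq_zero, smul_eq_mul] at h2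
  rw [h2, mul_comm]

/-- As `-τ` is a positive constant times `k²`, `du = -dk/k = -(k/2) η`. -/
theorem grad_log_scal (x : M) :
    grad g (fun x ↦ -Real.log (-scal g x) / 2) x = -(k x / 2) • xi g x := by
  refine eq_of_inner g fun v ↦ ?_
  have h := scal_neg_of_isB0 hJ hB hn hR ha hb x
  have hd : HasDerivAt (fun t ↦ -Real.log (-t) / 2) (-(-1 / -scal g x) / 2) (scal g x) :=
    (((hasDerivAt_id _).neg.log (by simpa using h.ne)).neg).div_const 2
  have hk : CMDiffAt ∞ k x := contMDiffAt_of_isB0 hJ hB (by omega) x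
  rw [inner_grad, mvfderiv_real_comp (φ := fun t ↦ -Real.log (-t) / 2) hd
    ((contMDiffAt_scal g).mdifferentiableAt (by simp)), scal_eq_of_isB0 hJ hB hn hR ha hb,
    mvfderiv_real_comp (φ := fun t ↦ -((n + 1) * (n + 2)) * t ^ 2)
      ((hasDerivAt_pow 2 _).const_mul _) (hk.mdifferentiableAt (by simp)),
    mvfderiv_k hJ hB hn hn3 hR ha hb]
  have := hB.k_ne x
  simp only [map_smul, smul_apply, smul_eq_mul]
  push_cast
  field_simp

theorem isFlat_log_scal :
    IsFlat (complexConformalConnection g J (fun x ↦ -Real.log (-scal g x) / 2)) := by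
  intro x X Y Z
  have hgrad := grad_log_scal hJ hB hn hn3 hR ha hb
  have hξ := inner_xi_self (hB.dscal_ne x)
  have hk : CMDiffAt ∞ k x := contMDiffAt_of_isB0 hJ hB (by omega) x
  have hc : CMDiffAt ∞ (fun y ↦ -(k y / 2)) x := (hk.div_const 2).neg
  rw [curvature_eq_of_hess hJ (contMDiff_log_scal hJ hB hn hR ha hb x) ?_]
  · rw [hgrad, phiForm_smul, hR, phiTensor_eq]
    simp only [map_smul, smul_apply, smul_eq_mul, hξ]
    have h1 := ha x
    have h2 := hb x
    -- With `P = -(k/2) ξ` the added terms are `k² π + 2k² Φ`, exactly opposite to `R`.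
    rw [show a x = -k x ^ 2 by linarith, show b x = -2 * k x ^ 2 by linarith]
    module
  · intro v
    have hfield : grad g (fun x ↦ -Real.log (-scal g x) / 2) = (fun y ↦ -(k y / 2)) • xi g :=
      funext hgrad
    rw [hgrad, hfield, cov_smul _ hc (smoothAt_xi (hB.dscal_ne x)),
      leviCivita_xi_of_isB0 hJ hB,
      mvfderiv_real_comp (φ := fun t ↦ -(t / 2)) (((hasDerivAt_id _).div_const 2).neg)
        (hk.mdifferentiableAt (by simp)), mvfderiv_k hJ hB hn hn3 hR ha hb,
      p_eq_of_isB0 hJ hB hn hn3 hR ha hb]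
    simp only [map_smul, smul_apply, smul_eq_mul, hξ, hJ.inner_left]
    module

end Converse

theorem exists_ne_of_grad_ne_zero {M : Type*} [TopologicalSpace M] [ChartedSpace E M]
    [IsManifold 𝓘(ℝ, E) ∞ M] (g : Metric 𝓘(ℝ, E) M) {u : M → ℝ} {x : M} (h : grad g u x ≠ 0) :
    ∃ y ∈ connectedComponent x, u y ≠ u x := by
  by_contra! hc
  have : LocallyConnectedSpace M := ChartedSpace.locallyConnectedSpace E M
  have he : u =ᶠ[𝓝 x] fun _ ↦ u x :=
    Filter.eventually_of_mem (isOpen_connectedComponent.mem_nhds mem_connectedComponent) hc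
  refine (grad_ne_zero_iff g).1 h ?_
  rw [mvfderiv_congr he, mvfderiv_const]

end

end KahlerGeom
end

/-! ### Assembly of the three claims -/

theorem theorem3p1 (n : ℕ) (hn : 3 ≤ n)
    {M : Type*} [TopologicalSpace M] [T2Space M] [SecondCountableTopology M]
    [ChartedSpace (EuclideanSpace ℝ (Fin (2 * n))) M]
    [IsManifold 𝓘(ℝ, EuclideanSpace ℝ (Fin (2 * n))) ∞ M]
    (g : KahlerGeom.Metric 𝓘(ℝ, EuclideanSpace ℝ (Fin (2 * n))) M)
    (J : KahlerGeom.EndField 𝓘(ℝ, EuclideanSpace ℝ (Fin (2 * n))) M)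
    (hJ : KahlerGeom.IsKahler g J) :
    -- the functions `a` and `b` are well defined
    (KahlerGeom.IsBochnerKahler n g J → ∀ k p : M → ℝ, KahlerGeom.IsB0 g J k p →
      ∃! ab : (M → ℝ) × (M → ℝ), KahlerGeom.IsCurvatureFunctions g J ab.1 ab.2) ∧
    -- the characterization
    ((∃ u : M → ℝ, ContMDiff 𝓘(ℝ, EuclideanSpace ℝ (Fin (2 * n))) 𝓘(ℝ, ℝ) ∞ u ∧
        (∀ x : M, ∃ y ∈ connectedComponent x, u y ≠ u x) ∧
        KahlerGeom.IsFlat (KahlerGeom.complexConformalConnection g J u)) ↔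
      KahlerGeom.IsSpecialBochnerKahler n g J) ∧
    -- the function that works in the converse direction
    (KahlerGeom.IsSpecialBochnerKahler n g J →
      (∀ x, KahlerGeom.scal g x < 0) ∧
      ContMDiff 𝓘(ℝ, EuclideanSpace ℝ (Fin (2 * n))) 𝓘(ℝ, ℝ) ∞
        (fun x ↦ -Real.log (-KahlerGeom.scal g x) / 2) ∧
      KahlerGeom.IsFlat (KahlerGeom.complexConformalConnection g J
        (fun x ↦ -Real.log (-KahlerGeom.scal g x) / 2))) := by
  have hfin : Module.finrank ℝ (EuclideanSpace ℝ (Fin (2 * n))) = 2 * n := by simp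
  have hdim : 2 < Module.finrank ℝ (EuclideanSpace ℝ (Fin (2 * n))) := by omega
  refine ⟨fun hBK k p hB ↦ ?_, ⟨?_, ?_⟩, ?_⟩
  · obtain ⟨a, b, hab⟩ := KahlerGeom.exists_isCurvatureFunctions hJ hB hfin hn hBK
    refine ⟨(a, b), hab, fun ab h ↦ ?_⟩
    obtain ⟨h1, h2⟩ := h.unique hJ hdim hB.dscal_ne hab
    exact Prod.ext h1 h2
  · rintro ⟨u, hu, hne, hflat⟩
    exact KahlerGeom.isSpecialBochnerKahler_of_flat hJ hu hdim hflat hfin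
      fun x ↦ KahlerGeom.grad_ne_zero_of_flat hJ hu hdim hflat (hne x)
  · rintro ⟨-, k, p, a, b, hB, hR, ha, -, hb⟩
    refine ⟨_, KahlerGeom.contMDiff_log_scal hJ hB hfin hR ha hb, fun x ↦ ?_,
      KahlerGeom.isFlat_log_scal hJ hB hfin hn hR ha hb⟩
    -- Nonconstancy on each component: the gradient `-(k/2) ξ` vanishes nowhere.
    refine KahlerGeom.exists_ne_of_grad_ne_zero g ?_
    rw [KahlerGeom.grad_log_scal hJ hB hfin hn hR ha hb]
    refine smul_ne_zero (by simpa using hB.k_ne x) fun h0 ↦ ?_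
    have h1 := KahlerGeom.inner_xi_self (hB.dscal_ne x)
    rw [h0, map_zero] at h1
    exact zero_ne_one h1
  · rintro ⟨-, k, p, a, b, hB, hR, ha, -, hb⟩
    exact ⟨KahlerGeom.scal_neg_of_isB0 hJ hB hfin hR ha hb,
      KahlerGeom.contMDiff_log_scal hJ hB hfin hR ha hb,
      KahlerGeom.isFlat_log_scal hJ hB hfin hn hR ha hb⟩
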